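/- All words are over the alphabet $\{0,1\}$ unless stated otherwise. An infinite word is Sturmian if it has exactly $n+1$ factors of length $n$ for each $n\ge 0$; a Sturmian word is standard if each of its prefixes $p$ is left special (both $0p$ and $1p$ are factors). A morphism of $\{0,1\}^*$ is Sturmian if it maps every Sturmian word to a Sturmian word, and a Sturmian morphism is standard if it fixes some standard Sturmian word. For a nonempty prefix $p$ of an infinite word $\mathbf u$, the return words to $p$ are the words $u_iu_{i+1}\cdots u_{j-1}$ where $i<j$ are consecutive occurrences of $p$ in $\mathbf u$. If $r_0,\dots,r_{k-1}$ are all the return words to $p$, listed without repetition, and $\mathbf u=r_{s_0}r_{s_1}r_{s_2}\cdots$, then $s_0s_1s_2\cdots$ is the derivated word of $\mathbf u$ with respect to $p$. Derivated words differing only by a permutation of letters are identified. Let $E$ be the morphism $0\mapsto 1,\ 1\mapsto 0$, and let $$\varphi_a:\ 0\mapsto 0,\ 1\mapsto 10;\qquad \varphi_b:\ 0\mapsto 0,\ 1\mapsto 01;\qquad \varphi_\alpha:\ 0\mapsto 01,\ 1\mapsto 1;\qquad \varphi_\beta:\ 0\mapsto 10,\ 1\mapsto 1.$$ For a word $w=w_1w_2\cdots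 w_n$ over $\{a,b,\alpha,\beta\}$ put $\varphi_w=\varphi_{w_1}\circ\varphi_{w_2}\circ\cdots\circ\varphi_{w_n}$, $|w|=n$, $\mathrm{cyc}(w)=w_2\cdots w_nw_1$ and $\mathrm{cyc}_F(w)=w_2\cdots w_nF(w_1)$, where $F$ exchanges $a\leftrightarrow\alpha$ and $b\leftrightarrow\beta$. **Proposition.** Let $\mathbf u$ be a fixed point of a standard Sturmian morphism $\psi$ which is not a power of any other Sturmian morphism. (i) If $\psi=\varphi_w$, then $\mathbf u$ has exactly $|w|$ distinct derivated words. Each of them is (up to a permutation of letters) fixed by one of the morphisms $\varphi_{v_0},\varphi_{v_1},\dots,\varphi_{v_{|w|-1}}$, where $v_k=\mathrm{cyc}^k(w)$, and each of these morphisms fixes (up to a permutation of letters) one of them. (ii) If $\psi=\varphi_w\circ E$, then $\mathbf u$ has exactly $|w|$ distinct derivated words. Each of them is (up to a permutation of letters) fixed by one of the morphisms $\varphi_{v_0}\circ E,\varphi_{v_1}\circ E,\dots,\varphi_{v_{|w|-1}}\circ E$, where $v_k=\mathrm{cyc}_F^k(w)$, and each of these morphisms fixes (up to a permutation of letters) one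 of them. -/

import Mathlib

namespace SturmWord

/-! ### Infinite words -/

/-- The finite word `u_i u_{i+1} ⋯ u_{i+n-1}` of length `n` read in `u` at position `i`. -/
def factorAt {A : Type*} (u : ℕ → A) (i n : ℕ) : List A :=
  (List.range n).map fun j => u (i + j)

/-- The prefix of length `n` of `u`. -/
def pref {A : Type*} (u : ℕ → A) (n : ℕ) : List A :=
  factorAt u 0 n

/-- The index `i` is an occurrence of the finite word `p` in `u`. -/
def OccursAt {A : Type*} (u : ℕ → A) (p : List A) (i : ℕ) : Prop :=
  factorAt u i p.length = p

/-- The language of `u`: the set of all its factors. -/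
def language {A : Type*} (u : ℕ → A) : Set (List A) :=
  {p | ∃ i, OccursAt u p i}

/-- The infinite word `v` is the concatenation `f 0 · f 1 · f 2 ⋯` of finite words
(and this concatenation is indeed infinite). -/
def IsInfConcat {A : Type*} (f : ℕ → List A) (v : ℕ → A) : Prop :=
  (∀ n, ((List.range n).map f).flatten = pref v ((List.range n).map f).flatten.length) ∧
    ∀ N, ∃ n, N ≤ ((List.range n).map f).flatten.length

/-! ### Derivated words -/

/-- The set of return words to `p` in `u`: the words `u_i u_{i+1} ⋯ u_{j-1}`, where `i < j` are
consecutive occurrences of `p` in `u`. -/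
def returnWords {A : Type*} (u : ℕ → A) (p : List A) : Set (List A) :=
  {r | ∃ i j, i < j ∧ OccursAt u p i ∧ OccursAt u p j ∧
    (∀ m, i < m → m < j → ¬ OccursAt u p m) ∧ r = factorAt u i (j - i)}

/-- `d` is a derivated word of `u` with respect to the prefix `p`: for some enumeration
`r_0, …, r_{k-1}` without repetition of the return words to `p`,
one has `u = r_{d_0} r_{d_1} r_{d_2} ⋯`. -/
def IsDerivatedWord {A : Type*} (u : ℕ → A) (p : List A) {k : ℕ} (d : ℕ → Fin k) : Prop :=
  ∃ r : Fin k → List A, Function.Injective r ∧ Set.range r = returnWords u p ∧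
    IsInfConcat (fun j => r (d j)) u

/-- Infinite words over the alphabets `{0, …, k-1}`, `k ∈ ℕ`, identified when they differ only by
a bijective renaming of the letters of their alphabets. -/
def letterRenaming : Setoid (Σ k : ℕ, (ℕ → Fin k)) where
  r x y := ∃ σ : Fin x.1 ≃ Fin y.1, ∀ i, y.2 i = σ (x.2 i)
  iseqv :=
    { refl := fun _ => ⟨Equiv.refl _, fun _ => rfl⟩
      symm := fun ⟨σ, h⟩ => ⟨σ.symm, fun i => by rw [h i, Equiv.symm_apply_apply]⟩
      trans := fun ⟨σ, h⟩ ⟨τ, h'⟩ =>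
        ⟨σ.trans τ, fun i => by rw [h' i, h i, Equiv.trans_apply]⟩ }

/-- An infinite word over a finite alphabet, up to a permutation of letters. -/
abbrev WordClass : Type := Quotient letterRenaming

/-- The class, up to a permutation of letters, of an infinite word. -/
def toClass {k : ℕ} (d : ℕ → Fin k) : WordClass := Quotient.mk letterRenaming ⟨k, d⟩

/-- `Der(u)`: the set of derivated words (up to a permutation of letters) of `u` with respect to
its nonempty prefixes. -/
def Der {A : Type*} (u : ℕ → A) : Set WordClass :=
  {c | ∃ n, 0 < n ∧ ∃ (k : ℕ) (d : ℕ → Fin k),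
    IsDerivatedWord u (pref u n) d ∧ c = toClass d}

/-! ### Sturmian words and Sturmian morphisms over `{0, 1}` -/

/-- `u` is Sturmian: it has exactly `n + 1` factors of each length `n`. -/
def IsSturmian (u : ℕ → Fin 2) : Prop :=
  ∀ n, {p ∈ language u | p.length = n}.ncard = n + 1

/-- `u` is standard Sturmian: it is Sturmian and each of its prefixes is left special. -/
def IsStandardSturmian (u : ℕ → Fin 2) : Prop :=
  IsSturmian u ∧ ∀ n, ∃ x y : Fin 2, x ≠ y ∧
    x :: pref u n ∈ language u ∧ y :: pref u n ∈ language u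

/-- Morphisms of the free monoid `{0, 1}*`; the product in this monoid is composition. -/
abbrev Morphism : Type := Monoid.End (FreeMonoid (Fin 2))

/-- `v = ψ(u)` for infinite words, i.e. `v = ψ(u_0) ψ(u_1) ψ(u_2) ⋯`. -/
def IsImage (ψ : Morphism) (u v : ℕ → Fin 2) : Prop :=
  IsInfConcat (fun j => (ψ (FreeMonoid.of (u j))).toList) v

/-- `ψ(u) = u`. -/
def IsFixedPoint (ψ : Morphism) (u : ℕ → Fin 2) : Prop := IsImage ψ u u

/-- `ψ` maps every Sturmian word to a Sturmian word. -/
def IsSturmianMorphism (ψ : Morphism) : Prop :=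
  ∀ u, IsSturmian u → ∃ v, IsImage ψ u v ∧ IsSturmian v

/-- A standard Sturmian morphism: a Sturmian morphism fixing some standard Sturmian word. -/
def IsStandardSturmianMorphism (ψ : Morphism) : Prop :=
  IsSturmianMorphism ψ ∧ ∃ c, IsStandardSturmian c ∧ IsFixedPoint ψ c

/-- The word class `c` is fixed by `ψ`, up to a permutation of letters. -/
def IsClassFixedBy (ψ : Morphism) (c : WordClass) : Prop :=
  ∃ x : ℕ → Fin 2, IsFixedPoint ψ x ∧ c = toClass x

/-- The morphism `0 ↦ x`, `1 ↦ y`. -/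
def mkMorphism (x y : List (Fin 2)) : Morphism :=
  FreeMonoid.lift ![FreeMonoid.ofList x, FreeMonoid.ofList y]

/-- The exchange morphism `E : 0 ↦ 1, 1 ↦ 0`. -/
def E : Morphism := mkMorphism [1] [0]

/-- The alphabet `{a, b, α, β}` of names of elementary morphisms. -/
inductive Gen where
  | a | b | α | β

/-- The elementary morphisms `φ_a, φ_b, φ_α, φ_β`. -/
def elem : Gen → Morphism
  | .a => mkMorphism [0] [1, 0]
  | .b => mkMorphism [0] [0, 1]
  | .α => mkMorphism [0, 1] [1]
  | .β => mkMorphism [1, 0] [1]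

/-- `φ_w = φ_{w_0} ∘ φ_{w_1} ∘ ⋯ ∘ φ_{w_{n-1}}` for `w = w_0 w_1 ⋯ w_{n-1}`. -/
def phi (w : List Gen) : Morphism := (w.map elem).prod

/-- The exchange `F : a ↔ α, b ↔ β`. -/
def F : Gen → Gen
  | .a => .α
  | .α => .a
  | .b => .β
  | .β => .b

/-- The cyclic shift `cyc(w_1 w_2 ⋯ w_n) = w_2 ⋯ w_n w_1`. -/
def cyc : List Gen → List Gen
  | [] => []
  | x :: w => w ++ [x]

/-- The twisted cyclic shift `cyc_F(w_1 w_2 ⋯ w_n) = w_2 ⋯ w_n F(w_1)`. -/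
def cycF : List Gen → List Gen
  | [] => []
  | x :: w => w ++ [F x]

end SturmWord

/-!
Write `std 0 = φ_b` and `std 1 = φ_β`: the morphism `std x` fixes the letter `x` and maps the other
letter `y` to `xy`. The letter `x` starts every block of `v = std x (u)` and occurs nowhere else in
it, so the blocks of `v` can be read off. Hence a factor `p` of `u` occurs at a position `n` exactly
when `std x (p) x` occurs in `v` at the start of the `n`-th block (`occursAt_std_iff`), and every
nonempty prefix of `v` has the same occurrences as `std x (p) x` for a shorter prefix `p` of `u`,
possibly empty (`exists_pref_std`). The derivated word of `v` with respect to this prefix is that of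
`u` with respect to `p`; for empty `p` it is `u` itself. So if `U 0 = std x₀ (U 1)`,
`U 1 = std x₁ (U 2)`, …, the derivated words of `U 0` are `U 1, U 2, …` (`der_eq`).

A standard Sturmian word `c` fixed by `φ_w` or by `φ_w ∘ E` is, for
nonempty `w`, its only fixed point (`fixedPoint_unique`), and it produces such a
chain, because only `b` and `β` occur in `w`
(`IsStandardSturmian.eq_map_stdGen`). Indeed `φ_a(u)` is `φ_b(u)` without its first letter, and
likewise for `α` and `β`, so that `c` is a shift of a standard Sturmian word; since the left special
factors of a standard Sturmian word are its prefixes, the shift is trivial, and Sturmian words are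
not periodic. Both cases are treated at once, for the morphism `stdProd l * ren ε`, where `ren ε` is
the identity or `E`. Moving the first letter of `l` to the end, renamed by `ε`, gives the name of a
morphism fixing the next word of the chain, and after `|l|` steps the chain returns to its start,
renamed by `ε`. This leaves at most `|l|` derivated words.

They are distinct. The first letters `s k` of the words `U k` determine the chain, so two equal
classes among `|l|` consecutive ones yield `0 < d < |l|` and a renaming `σ` with
`s (t + d) = σ (s t)` for all `t`. The least such `d` divides `|l|`, and so the morphism is a proper
power `(stdProd m * ren τ) ^ k` (`exists_root`). The base is a Sturmian morphism, since the morphisms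
`std x` preserve the existence of exactly one right special factor of each length
(`IsSturmian.img_std`), and it differs from its powers by the growth of the lengths of images; this
contradicts the assumption that the given morphism is not a power of another Sturmian morphism.
-/

namespace SturmWord

/-! ### Factors and occurrences -/

section Factors

variable {A : Type*} (u : ℕ → A)

@[simp] theorem length_factorAt (i n : ℕ) : (factorAt u i n).length = n := by
  simp [factorAt]

@[simp] theorem length_pref (n : ℕ) : (pref u n).length = n := length_factorAt u 0 n

@[simp] theorem pref_zero : pref u 0 = [] := rfl

theorem factorAt_add (i m n : ℕ) :
    factorAt u i (m + n) = factorAt u i m ++ factorAt u (i + m) n := by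
  simp [factorAt, List.range_add, Function.comp_def, add_assoc]

theorem factorAt_one (i : ℕ) : factorAt u i 1 = [u i] := by
  simp [factorAt]

theorem factorAt_succ (i n : ℕ) : factorAt u i (n + 1) = u i :: factorAt u (i + 1) n := by
  rw [add_comm, factorAt_add, factorAt_one]; rfl

theorem pref_add (m n : ℕ) : pref u (m + n) = pref u m ++ factorAt u m n := by
  simp [pref, factorAt_add]

theorem pref_succ (n : ℕ) : pref u (n + 1) = pref u n ++ [u n] := by
  rw [pref_add, factorAt_one]

theorem getElem_pref {n i : ℕ} (h : i < (pref u n).length) : (pref u n)[i] = u i := by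
  simp [pref, factorAt]

variable {u}

@[simp] theorem occursAt_nil (i : ℕ) : OccursAt u [] i := rfl

theorem occursAt_cons {a : A} {p : List A} {i : ℕ} :
    OccursAt u (a :: p) i ↔ u i = a ∧ OccursAt u p (i + 1) := by
  simp [OccursAt, factorAt_succ]

theorem occursAt_append {p q : List A} {i : ℕ} :
    OccursAt u (p ++ q) i ↔ OccursAt u p i ∧ OccursAt u q (i + p.length) := by
  rw [OccursAt, List.length_append, factorAt_add]
  exact ⟨fun h => List.append_inj h (by simp), fun h => congrArg₂ _ h.1 h.2⟩

theorem occursAt_singleton {a : A} {i : ℕ} : OccursAt u [a] i ↔ u i = a := by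
  simp [occursAt_cons]

theorem occursAt_factorAt (i n : ℕ) : OccursAt u (factorAt u i n) i := by
  simp [OccursAt]

theorem occursAt_pref (n : ℕ) : OccursAt u (pref u n) 0 := occursAt_factorAt 0 n

theorem factorAt_mem_language (i n : ℕ) : factorAt u i n ∈ language u :=
  ⟨i, occursAt_factorAt i n⟩

theorem language_of_infix {p q : List A} (h : p <:+: q) (hq : q ∈ language u) :
    p ∈ language u := by
  obtain ⟨s, t, rfl⟩ := h
  obtain ⟨i, hi⟩ := hq
  exact ⟨_, (occursAt_append.1 (occursAt_append.1 hi).1).2⟩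

theorem eq_of_pref_eq {v : ℕ → A} (h : ∀ n, pref u n = pref v n) : u = v := by
  funext n
  have := h (n + 1)
  rw [pref_succ, pref_succ, h n] at this
  simpa using this

theorem pref_eq_of_le {v : ℕ → A} {m n : ℕ} (hmn : m ≤ n) (h : pref u n = pref v n) :
    pref u m = pref v m := by
  obtain ⟨k, rfl⟩ := Nat.exists_eq_add_of_le hmn
  rw [pref_add, pref_add] at h
  exact (List.append_inj h (by simp)).1

end Factors

/-! ### Images of words under morphisms -/

/-- The image `ψ(l)` of a finite word, with words encoded as lists rather than as elements of the
free monoid. -/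
def app (ψ : Morphism) (l : List (Fin 2)) : List (Fin 2) :=
  (ψ (FreeMonoid.ofList l)).toList

@[simp] theorem app_nil (ψ : Morphism) : app ψ [] = [] := by
  change (ψ 1).toList = []
  simp

theorem app_append (ψ : Morphism) (l m : List (Fin 2)) :
    app ψ (l ++ m) = app ψ l ++ app ψ m := by
  simp [app, FreeMonoid.ofList_append]

theorem app_cons (ψ : Morphism) (i : Fin 2) (m : List (Fin 2)) :
    app ψ (i :: m) = app ψ [i] ++ app ψ m :=
  app_append ψ [i] m

theorem app_mul (χ ψ : Morphism) (l : List (Fin 2)) : app (χ * ψ) l = app χ (app ψ l) := by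
  simp [app]

@[simp] theorem app_one (l : List (Fin 2)) : app 1 l = l := rfl

theorem morphism_ext {χ ψ : Morphism} (h : ∀ i, app χ [i] = app ψ [i]) : χ = ψ :=
  FreeMonoid.hom_eq fun i => FreeMonoid.toList.injective (h i)

/-- No letter is mapped to the empty word. -/
def NonErasing (ψ : Morphism) : Prop := ∀ i, app ψ [i] ≠ []

theorem NonErasing.length_le {ψ : Morphism} (h : NonErasing ψ) (l : List (Fin 2)) :
    l.length ≤ (app ψ l).length := by
  induction l with
  | nil => simp
  | cons i l ih =>
    have := List.length_pos_of_ne_nil (h i)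
    rw [app_cons]
    simp only [List.length_cons, List.length_append]
    omega

theorem NonErasing.mul {χ ψ : Morphism} (hχ : NonErasing χ) (hψ : NonErasing ψ) :
    NonErasing (χ * ψ) := by
  intro i h
  have h1 := hχ.length_le (app ψ [i])
  have h2 := List.length_pos_of_ne_nil (hψ i)
  rw [← app_mul, h] at h1
  simp at h1
  simp [h1] at h2

theorem nonErasing_one : NonErasing 1 := by simp [NonErasing]

/-- The position, in the image of `u` under `ψ`, at which the image of the letter `u n` starts. -/
def cut (ψ : Morphism) (u : ℕ → Fin 2) (n : ℕ) : ℕ := (app ψ (pref u n)).length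

theorem flatten_map_range (ψ : Morphism) (u : ℕ → Fin 2) (n : ℕ) :
    ((List.range n).map fun j => (ψ (FreeMonoid.of (u j))).toList).flatten = app ψ (pref u n) := by
  induction n with
  | zero => simp
  | succ n ih =>
    rw [List.range_succ, List.map_append, List.flatten_append, ih, pref_succ, app_append]
    simp [app]

theorem isImage_iff {ψ : Morphism} {u v : ℕ → Fin 2} :
    IsImage ψ u v ↔ (∀ n, app ψ (pref u n) = pref v (cut ψ u n)) ∧ ∀ N, ∃ n, N ≤ cut ψ u n := by
  simp only [IsImage, IsInfConcat, flatten_map_range, cut]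

theorem cut_zero (ψ : Morphism) (u : ℕ → Fin 2) : cut ψ u 0 = 0 := by simp [cut]

theorem cut_add (ψ : Morphism) (u : ℕ → Fin 2) (m n : ℕ) :
    cut ψ u (m + n) = cut ψ u m + (app ψ (factorAt u m n)).length := by
  simp [cut, pref_add, app_append]

theorem cut_succ (ψ : Morphism) (u : ℕ → Fin 2) (n : ℕ) :
    cut ψ u (n + 1) = cut ψ u n + (app ψ [u n]).length := by
  rw [cut_add, factorAt_one]

/-- The image of an infinite word under a nonerasing morphism (a junk value for other morphisms):
its letter at position `i` is read in the image of the prefix of length `i + 1`. -/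
def img (ψ : Morphism) (u : ℕ → Fin 2) : ℕ → Fin 2 :=
  fun i => (app ψ (pref u (i + 1))).getD i 0

section Image

variable {χ ψ : Morphism} {u v : ℕ → Fin 2}

theorem NonErasing.le_cut (hψ : NonErasing ψ) (n : ℕ) : n ≤ cut ψ u n := by
  simpa [cut] using hψ.length_le (pref u n)

theorem NonErasing.cut_strictMono (hψ : NonErasing ψ) : StrictMono (cut ψ u) :=
  strictMono_nat_of_lt_succ fun n => by
    rw [cut_succ]
    have := List.length_pos_of_ne_nil (hψ (u n))
    omega

theorem isImage_img (hψ : NonErasing ψ) : IsImage ψ u (img ψ u) := by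
  refine isImage_iff.2 ⟨fun n => ?_, fun N => ⟨N, hψ.le_cut N⟩⟩
  refine List.ext_getElem (by simp [cut]) fun i h1 h2 => ?_
  rw [getElem_pref, img]
  have h3 : i < (app ψ (pref u (i + 1))).length := hψ.le_cut (u := u) (i + 1)
  rw [List.getD_eq_getElem _ _ h3]
  rcases le_total n (i + 1) with h | h
  · obtain ⟨k, hk⟩ := Nat.exists_eq_add_of_le h
    simp only [hk, pref_add, app_append]
    rw [List.getElem_append_left]
  · obtain ⟨k, rfl⟩ := Nat.exists_eq_add_of_le h
    simp only [pref_add u (i + 1), app_append]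
    rw [List.getElem_append_left]

theorem isImage_iff_eq (hψ : NonErasing ψ) : IsImage ψ u v ↔ v = img ψ u := by
  refine ⟨fun h => eq_of_pref_eq fun n => ?_, fun h => h ▸ isImage_img hψ⟩
  refine pref_eq_of_le (hψ.le_cut (u := u) n) ?_
  rw [← (isImage_iff.1 h).1, ← (isImage_iff.1 (isImage_img hψ)).1]

theorem pref_img (hψ : NonErasing ψ) (n : ℕ) : pref (img ψ u) (cut ψ u n) = app ψ (pref u n) :=
  ((isImage_iff.1 (isImage_img hψ)).1 n).symm

theorem factorAt_img (hψ : NonErasing ψ) (m n : ℕ) :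
    factorAt (img ψ u) (cut ψ u m) (cut ψ u (m + n) - cut ψ u m) = app ψ (factorAt u m n) := by
  have h := pref_img hψ (u := u) (m + n)
  have h1 : cut ψ u (m + n) = cut ψ u m + (cut ψ u (m + n) - cut ψ u m) := by
    rw [cut_add]; omega
  rw [h1, pref_add, pref_img hψ, pref_add, app_append] at h
  exact List.append_cancel_left h

theorem occursAt_img (hψ : NonErasing ψ) {p : List (Fin 2)} {n : ℕ} (h : OccursAt u p n) :
    OccursAt (img ψ u) (app ψ p) (cut ψ u n) := by
  have h2 := factorAt_img hψ (u := u) n p.length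
  rw [h, cut_add, h] at h2
  simpa [OccursAt] using h2

theorem img_mul (hψ : NonErasing ψ) (hχ : NonErasing χ) : img (χ * ψ) u = img χ (img ψ u) := by
  refine ((isImage_iff_eq (hχ.mul hψ)).1 (isImage_iff.2 ⟨fun n => ?_, fun N =>
    ⟨N, (hχ.mul hψ).le_cut N⟩⟩)).symm
  have h := pref_img hχ (u := img ψ u) (cut ψ u n)
  have h2 : cut (χ * ψ) u n = cut χ (img ψ u) (cut ψ u n) := by
    rw [cut, cut, app_mul, pref_img hψ]
  rw [app_mul, ← pref_img hψ, ← h, h2]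

theorem img_drop (hψ : NonErasing ψ) (m : ℕ) :
    img ψ (fun i => u (m + i)) = fun i => img ψ u (cut ψ u m + i) := by
  refine ((isImage_iff_eq hψ).1 (isImage_iff.2 ⟨fun n => ?_, fun N =>
    ⟨N, hψ.le_cut N⟩⟩)).symm
  have h1 : ∀ (x : ℕ → Fin 2) k n, pref (fun i => x (k + i)) n = factorAt x k n := by
    intro x k n; simp [pref, factorAt]
  have h2 : cut ψ (fun i => u (m + i)) n = cut ψ u (m + n) - cut ψ u m := by
    rw [cut, h1, cut_add]; omega
  rw [h1, h1, h2, factorAt_img hψ]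

end Image

@[simp] theorem img_one (u : ℕ → Fin 2) : img 1 u = u :=
  ((isImage_iff_eq nonErasing_one).1 (isImage_iff.2 ⟨fun n => by simp [cut], fun N =>
    ⟨N, nonErasing_one.le_cut N⟩⟩)).symm

/-! ### Elementary standard morphisms -/

theorem app_lift (f : Fin 2 → FreeMonoid (Fin 2)) (y : Fin 2) :
    app (FreeMonoid.lift f) [y] = (f y).toList :=
  congrArg FreeMonoid.toList (FreeMonoid.lift_eval_of f y)

/-- The morphism `x ↦ x`, `y ↦ xy` for `y ≠ x`; it is `φ_b` for `x = 0` and `φ_β` for `x = 1`. -/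
def std (x : Fin 2) : Morphism :=
  FreeMonoid.lift fun y => FreeMonoid.ofList (if y = x then [x] else [x, y])

theorem app_std (x y : Fin 2) : app (std x) [y] = if y = x then [x] else [x, y] := by
  exact app_lift _ y

theorem app_std_self (x : Fin 2) : app (std x) [x] = [x] := by simp [app_std]

theorem app_std_of_ne {x y : Fin 2} (h : y ≠ x) : app (std x) [y] = [x, y] := by
  simp [app_std, h]

theorem nonErasing_std (x : Fin 2) : NonErasing (std x) := by
  intro y
  rw [app_std]
  split_ifs <;> simp

theorem fin_two_eq_of_ne {x y z : Fin 2} (hy : y ≠ x) (hz : z ≠ x) : y = z := by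
  omega

section Std

variable {x : Fin 2} {u : ℕ → Fin 2}

theorem cut_std_succ_of_eq {n : ℕ} (h : u n = x) :
    cut (std x) u (n + 1) = cut (std x) u n + 1 := by
  rw [cut_succ, h, app_std_self]; rfl

theorem cut_std_succ_of_ne {n : ℕ} (h : u n ≠ x) :
    cut (std x) u (n + 1) = cut (std x) u n + 2 := by
  rw [cut_succ, app_std_of_ne h]; rfl

theorem img_std_cut (n : ℕ) : img (std x) u (cut (std x) u n) = x := by
  have h := occursAt_img (nonErasing_std x) (occursAt_singleton.2 (rfl : u n = u n))
  rw [app_std] at h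
  split_ifs at h <;> exact (occursAt_cons.1 h).1

theorem img_std_cut_add_one {n : ℕ} (h : u n ≠ x) :
    img (std x) u (cut (std x) u n + 1) = u n := by
  have h1 := occursAt_img (nonErasing_std x) (occursAt_singleton.2 (rfl : u n = u n))
  rw [app_std_of_ne h] at h1
  exact occursAt_singleton.1 (occursAt_cons.1 h1).2

/-- Every position of the image is the start of a block or the second position of a block of
length two. -/
theorem exists_cut_std (i : ℕ) :
    ∃ n, i = cut (std x) u n ∨ (u n ≠ x ∧ i = cut (std x) u n + 1) := by
  induction i with
  | zero => exact ⟨0, Or.inl (cut_zero _ _).symm⟩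
  | succ i ih =>
    obtain ⟨n, rfl | ⟨h, rfl⟩⟩ := ih
    · by_cases h : u n = x
      · exact ⟨n + 1, Or.inl (cut_std_succ_of_eq h).symm⟩
      · exact ⟨n, Or.inr ⟨h, rfl⟩⟩
    · exact ⟨n + 1, Or.inl (cut_std_succ_of_ne h).symm⟩

theorem exists_cut_std_of_eq {i : ℕ} (h : img (std x) u i = x) : ∃ n, i = cut (std x) u n := by
  obtain ⟨n, hn | ⟨hn, rfl⟩⟩ := exists_cut_std (x := x) (u := u) i
  · exact ⟨n, hn⟩
  · exact absurd (img_std_cut_add_one hn ▸ h) hn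

theorem exists_cut_std_of_ne {i : ℕ} (h : img (std x) u i ≠ x) :
    ∃ n, u n ≠ x ∧ i = cut (std x) u n + 1 := by
  obtain ⟨n, rfl | hn⟩ := exists_cut_std (x := x) (u := u) i
  · exact absurd (img_std_cut n) h
  · exact ⟨n, hn⟩

theorem img_std_succ_of_ne {i : ℕ} (h : img (std x) u i ≠ x) : img (std x) u (i + 1) = x := by
  obtain ⟨n, hn, rfl⟩ := exists_cut_std_of_ne h
  rw [add_assoc, ← cut_std_succ_of_ne hn, img_std_cut]

theorem img_std_pred_of_ne {i : ℕ} (h : img (std x) u i ≠ x) :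
    ∃ j, i = j + 1 ∧ img (std x) u j = x := by
  obtain ⟨n, hn, rfl⟩ := exists_cut_std_of_ne h
  exact ⟨_, rfl, img_std_cut n⟩

theorem occursAt_app_std_append_head {l m : List (Fin 2)} {i : ℕ}
    (h : OccursAt u (app (std x) l ++ x :: m) i) : u i = x := by
  cases l with
  | nil => exact (occursAt_cons.1 h).1
  | cons y l =>
    rw [app_cons, app_std] at h
    split_ifs at h <;> exact (occursAt_cons.1 h).1

/-- Occurrences of `l` in `u` correspond to occurrences of `φ(l) x` in `φ(u)`: the extra letter `x`
marks the end of the last block of `φ(l)`. -/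
theorem occursAt_cut_std_iff {l : List (Fin 2)} {n : ℕ} :
    OccursAt (img (std x) u) (app (std x) l ++ [x]) (cut (std x) u n) ↔ OccursAt u l n := by
  induction l generalizing n with
  | nil => simp [occursAt_singleton, img_std_cut]
  | cons y l ih =>
    rw [app_cons, List.append_assoc, occursAt_append, occursAt_cons]
    by_cases hy : u n = y
    · subst hy
      have h := occursAt_img (nonErasing_std x) (occursAt_singleton.2 (rfl : u n = u n))
      rw [← cut_succ, ih]
      simp [h]
    · simp only [hy, false_and, iff_false, not_and]
      intro h1 h2
      by_cases hx : y = x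
      · subst hx
        rw [app_std_self] at h2
        have h3 := occursAt_app_std_append_head h2
        simp only [List.length_singleton] at h3
        rw [img_std_cut_add_one hy] at h3
        exact hy h3
      · rw [app_std_of_ne hx] at h1
        have h3 := occursAt_singleton.1 (occursAt_cons.1 h1).2
        have h4 : u n = x := by omega
        rw [← cut_std_succ_of_eq h4, img_std_cut] at h3
        exact hx h3.symm

theorem occursAt_std_iff {l : List (Fin 2)} {i : ℕ} :
    OccursAt (img (std x) u) (app (std x) l ++ [x]) i ↔
      ∃ n, i = cut (std x) u n ∧ OccursAt u l n := by
  constructor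
  · intro h
    obtain ⟨n, rfl⟩ := exists_cut_std_of_eq (occursAt_app_std_append_head h)
    exact ⟨n, rfl, occursAt_cut_std_iff.1 h⟩
  · rintro ⟨n, rfl, h⟩
    exact occursAt_cut_std_iff.2 h

theorem app_std_mem_language_iff {l : List (Fin 2)} :
    app (std x) l ++ [x] ∈ language (img (std x) u) ↔ l ∈ language u := by
  constructor
  · rintro ⟨i, hi⟩
    obtain ⟨n, -, hn⟩ := occursAt_std_iff.1 hi
    exact ⟨n, hn⟩
  · rintro ⟨n, hn⟩
    exact ⟨_, occursAt_cut_std_iff.2 hn⟩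

theorem app_std_injective (x : Fin 2) : Function.Injective (app (std x)) := by
  intro l
  induction l with
  | nil =>
    rintro (_ | ⟨z, m⟩) h
    · rfl
    · rw [app_cons, app_std] at h
      split_ifs at h <;> simp at h
  | cons y l ih =>
    rintro (_ | ⟨z, m⟩) h
    · rw [app_cons, app_std] at h
      split_ifs at h <;> simp at h
    · have key : ∀ (l m : List (Fin 2)) (z : Fin 2), z ≠ x → app (std x) l ≠ z :: m := by
        rintro (_ | ⟨a, l⟩) m z hz h
        · simp at h
        · rw [app_cons, app_std] at h
          split_ifs at h <;> simp at h <;> exact hz h.1.symm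
      rw [app_cons, app_cons _ z] at h
      by_cases hy : y = x <;> by_cases hz : z = x
      · subst hy hz
        rw [app_std_self] at h
        rw [ih (List.append_cancel_left h)]
      · subst hy
        rw [app_std_self, app_std_of_ne hz] at h
        simp at h
        exact absurd h (key _ _ _ hz)
      · subst hz
        rw [app_std_self, app_std_of_ne hy] at h
        simp at h
        exact absurd h.symm (key _ _ _ hy)
      · rw [app_std_of_ne hy, app_std_of_ne hz] at h
        simp at h
        rw [h.1, ih h.2]

theorem img_std_injective (x : Fin 2) : Function.Injective (img (std x)) := by
  intro u v h
  refine eq_of_pref_eq fun n => ?_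
  have h1 : OccursAt u (pref v n) 0 := by
    rw [← occursAt_cut_std_iff (x := x), h, cut_zero, ← cut_zero (std x) v, occursAt_cut_std_iff]
    exact occursAt_pref n
  simpa [OccursAt, pref] using h1

/-! ### Return words and derivated words of an image -/

theorem returnWords_congr {A : Type*} {u : ℕ → A} {p q : List A}
    (h : ∀ i, OccursAt u p i ↔ OccursAt u q i) : returnWords u p = returnWords u q := by
  simp only [returnWords, h]

theorem isDerivatedWord_congr {A : Type*} {u : ℕ → A} {p q : List A}
    (h : ∀ i, OccursAt u p i ↔ OccursAt u q i) {k : ℕ} {d : ℕ → Fin k} :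
    IsDerivatedWord u p d ↔ IsDerivatedWord u q d := by
  simp only [IsDerivatedWord, returnWords_congr h]

theorem factorAt_cut_std {i j : ℕ} (h : i ≤ j) :
    factorAt (img (std x) u) (cut (std x) u i) (cut (std x) u j - cut (std x) u i) =
      app (std x) (factorAt u i (j - i)) := by
  obtain ⟨k, rfl⟩ := Nat.exists_eq_add_of_le h
  rw [factorAt_img (nonErasing_std x), Nat.add_sub_cancel_left]

theorem returnWords_std (p : List (Fin 2)) :
    returnWords (img (std x) u) (app (std x) p ++ [x]) = app (std x) '' returnWords u p := by
  have hmono : StrictMono (cut (std x) u) := (nonErasing_std x).cut_strictMono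
  ext r
  simp only [returnWords, Set.mem_ofPred_eq, Set.mem_image]
  constructor
  · rintro ⟨i, j, hij, hi, hj, hm, rfl⟩
    obtain ⟨i, rfl, hi'⟩ := occursAt_std_iff.1 hi
    obtain ⟨j, rfl, hj'⟩ := occursAt_std_iff.1 hj
    have hij' := hmono.lt_iff_lt.1 hij
    refine ⟨_, ⟨i, j, hij', hi', hj', fun m h1 h2 h3 => ?_, rfl⟩,
      (factorAt_cut_std hij'.le).symm⟩
    exact hm _ (hmono h1) (hmono h2) (occursAt_cut_std_iff.2 h3)
  · rintro ⟨_, ⟨i, j, hij, hi, hj, hm, rfl⟩, rfl⟩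
    refine ⟨_, _, hmono hij, occursAt_cut_std_iff.2 hi, occursAt_cut_std_iff.2 hj,
      fun m h1 h2 h3 => ?_, (factorAt_cut_std hij.le).symm⟩
    obtain ⟨m, rfl, h4⟩ := occursAt_std_iff.1 h3
    exact hm m (hmono.lt_iff_lt.1 h1) (hmono.lt_iff_lt.1 h2) h4

/-- The concatenation of the first `n` words of a sequence. -/
def concat {A : Type*} (f : ℕ → List A) (n : ℕ) : List A := ((List.range n).map f).flatten

theorem concat_succ {A : Type*} (f : ℕ → List A) (n : ℕ) : concat f (n + 1) = concat f n ++ f n := by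
  simp [concat, List.range_succ]

theorem concat_add {A : Type*} (f : ℕ → List A) (m n : ℕ) :
    ∃ l, concat f (m + n) = concat f m ++ l := by
  simp [concat, List.range_add]

theorem concat_app (ψ : Morphism) (f : ℕ → List (Fin 2)) (n : ℕ) :
    concat (fun j => app ψ (f j)) n = app ψ (concat f n) := by
  induction n with
  | zero => simp [concat]
  | succ n ih => rw [concat_succ, concat_succ, ih, app_append]

theorem isInfConcat_iff {A : Type*} {f : ℕ → List A} {v : ℕ → A} :
    IsInfConcat f v ↔ (∀ n, OccursAt v (concat f n) 0) ∧ ∀ N, ∃ n, N ≤ (concat f n).length := by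
  simp only [IsInfConcat, concat, OccursAt, pref, eq_comm]

theorem length_app_std_le (l : List (Fin 2)) : (app (std x) l).length ≤ 2 * l.length := by
  induction l with
  | nil => simp
  | cons y l ih =>
    rw [app_cons, List.length_append, List.length_cons, app_std]
    split_ifs <;> simp <;> omega

/-- Factorizations of `φ(u)` into images of words are images of factorizations of `u`. -/
theorem isInfConcat_std {f : ℕ → List (Fin 2)} :
    IsInfConcat (fun j => app (std x) (f j)) (img (std x) u) ↔ IsInfConcat f u := by
  simp only [isInfConcat_iff, concat_app]
  constructor
  · rintro ⟨h1, h2⟩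
    have h3 : ∀ N, ∃ n, N ≤ (concat f n).length := by
      intro N
      obtain ⟨n, hn⟩ := h2 (2 * N)
      exact ⟨n, by have := length_app_std_le (x := x) (concat f n); omega⟩
    refine ⟨fun n => ?_, h3⟩
    obtain ⟨m, hm⟩ := h3 ((concat f n).length + 1)
    -- A longer concatenation provides the letter `x` after the image of the first `n` words.
    have hnm : n ≤ m := by
      by_contra! hlt
      obtain ⟨k, rfl⟩ := Nat.exists_eq_add_of_le hlt.le
      obtain ⟨l, hl⟩ := concat_add f m k
      rw [hl, List.length_append] at hm
      omega
    obtain ⟨k, rfl⟩ := Nat.exists_eq_add_of_le hnm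
    obtain ⟨l, hl⟩ := concat_add f n k
    have h4 := h1 (n + k)
    rw [hl, app_append] at h4
    cases l with
    | nil => rw [hl] at hm; simp at hm
    | cons y l =>
      have h5 : OccursAt (img (std x) u) (app (std x) (concat f n) ++ [x]) 0 := by
        rw [occursAt_append] at h4 ⊢
        refine ⟨h4.1, occursAt_singleton.2 ?_⟩
        have h6 := h4.2
        rw [app_cons, app_std] at h6
        split_ifs at h6 <;> exact (occursAt_cons.1 h6).1
      rw [← cut_zero (std x) u] at h5
      exact occursAt_cut_std_iff.1 h5
  · rintro ⟨h1, h2⟩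
    refine ⟨fun n => ?_, fun N => ?_⟩
    · have := occursAt_img (nonErasing_std x) (h1 n)
      rwa [cut_zero] at this
    · obtain ⟨n, hn⟩ := h2 N
      exact ⟨n, hn.trans ((nonErasing_std x).length_le _)⟩

/-- The empty word `p` is allowed: then `std x (p) x` is the one-letter word `x`. -/
theorem isDerivatedWord_std {p : List (Fin 2)} {k : ℕ} {d : ℕ → Fin k} :
    IsDerivatedWord (img (std x) u) (app (std x) p ++ [x]) d ↔ IsDerivatedWord u p d := by
  have hinj := app_std_injective x
  constructor
  · rintro ⟨r, hr, hrange, hr3⟩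
    have h1 : ∀ i, ∃ l, l ∈ returnWords u p ∧ app (std x) l = r i := fun i => by
      have : r i ∈ app (std x) '' returnWords u p := by
        rw [← returnWords_std, ← hrange]; exact Set.mem_range_self i
      exact this
    choose r' hr' hr'' using h1
    obtain rfl : (fun i => app (std x) (r' i)) = r := funext hr''
    refine ⟨r', fun i j h => hr (by simp [h]), ?_, isInfConcat_std.1 hr3⟩
    have h2 : app (std x) '' Set.range r' = app (std x) '' returnWords u p := by
      rw [← returnWords_std, ← hrange, ← Set.range_comp]; rfl
    exact hinj.image_injective h2
  · rintro ⟨r, hr, hrange, hr3⟩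
    refine ⟨fun i => app (std x) (r i), hinj.comp hr, ?_, isInfConcat_std.2 hr3⟩
    rw [returnWords_std, ← hrange, ← Set.range_comp]; rfl

end Std

theorem returnWords_nil (u : ℕ → Fin 2) : returnWords u [] = Set.range fun i => [u i] := by
  ext r
  simp only [returnWords, Set.mem_ofPred_eq, Set.mem_range, occursAt_nil]
  constructor
  · rintro ⟨i, j, hij, -, -, hm, rfl⟩
    have : j - i = 1 := by
      by_contra h
      exact hm (i + 1) (by omega) (by omega) trivial
    exact ⟨i, by rw [this, factorAt_one]⟩
  · rintro ⟨i, rfl⟩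
    exact ⟨i, i + 1, by omega, trivial, trivial, fun m h1 h2 => by omega, by
      rw [Nat.add_sub_cancel_left, factorAt_one]⟩

theorem concat_singleton {A : Type*} (v : ℕ → A) (n : ℕ) : concat (fun j => [v j]) n = pref v n := by
  induction n with
  | zero => rfl
  | succ n ih => rw [concat_succ, pref_succ, ih]

theorem isInfConcat_singleton {A : Type*} {u v : ℕ → A} :
    IsInfConcat (fun j => [v j]) u ↔ v = u := by
  simp only [isInfConcat_iff, concat_singleton, OccursAt, length_pref]
  exact ⟨fun h => eq_of_pref_eq fun n => (h.1 n).symm, fun h => by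
    subst h; exact ⟨fun _ => rfl, fun N => ⟨N, le_rfl⟩⟩⟩

/-- With respect to the empty prefix, the return words are the letters, so the derivated word is
the word itself. -/
theorem isDerivatedWord_nil {u : ℕ → Fin 2} (hu : Function.Surjective u) {k : ℕ}
    {d : ℕ → Fin k} : IsDerivatedWord u [] d ↔ toClass d = toClass u := by
  have hrange : returnWords u [] = Set.range fun y : Fin 2 => [y] := by
    rw [returnWords_nil]
    exact hu.range_comp fun y => [y]
  constructor
  · rintro ⟨r, hr, hr2, hr3⟩
    have h1 : ∀ i, ∃ y, [y] = r i := fun i => by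
      have : r i ∈ Set.range fun y : Fin 2 => [y] := by
        rw [← hrange, ← hr2]; exact Set.mem_range_self i
      exact this
    choose σ hσ using h1
    obtain rfl : (fun i => [σ i]) = r := funext hσ
    have hb : Function.Bijective σ := by
      refine ⟨fun i j h => hr (by simp [h]), fun y => ?_⟩
      have : [y] ∈ Set.range fun i => [σ i] := by rw [hr2, hrange]; exact ⟨y, rfl⟩
      obtain ⟨i, hi⟩ := this
      exact ⟨i, by simpa using hi⟩
    refine Quotient.sound ⟨Equiv.ofBijective σ hb, fun i => ?_⟩
    exact (congrFun (isInfConcat_singleton.1 hr3) i).symm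
  · intro h
    obtain ⟨σ, hσ⟩ := Quotient.exact h
    refine ⟨fun i => [σ i], fun i j h => σ.injective (by simpa using h), ?_, ?_⟩
    · rw [hrange]
      exact σ.surjective.range_comp fun y => [y]
    · exact isInfConcat_singleton.2 (funext fun i => (hσ i).symm)

/-! ### The set of derivated words along a desubstitution -/

section Chain

variable {x : Fin 2} {u : ℕ → Fin 2}

theorem pref_img_std (m : ℕ) :
    pref (img (std x) u) (cut (std x) u m + 1) = app (std x) (pref u m) ++ [x] := by
  rw [pref_succ, pref_img (nonErasing_std x), img_std_cut]

/-- A nonempty prefix of `φ(u)` has the same occurrences as `φ(p) x` for a shorter prefix `p` of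
`u`. -/
theorem exists_pref_std {n : ℕ} (hn : 0 < n) : ∃ m < n, ∀ i,
    OccursAt (img (std x) u) (pref (img (std x) u) n) i ↔
      OccursAt (img (std x) u) (app (std x) (pref u m) ++ [x]) i := by
  obtain ⟨n, rfl⟩ := Nat.exists_eq_succ_of_ne_zero hn.ne'
  obtain ⟨m, rfl | ⟨hm, rfl⟩⟩ := exists_cut_std (x := x) (u := u) n
  · refine ⟨m, Nat.lt_succ_of_le ((nonErasing_std x).le_cut m), fun i => ?_⟩
    rw [Nat.succ_eq_add_one, pref_img_std]
  · refine ⟨m + 1, Nat.succ_lt_succ (Nat.lt_succ_of_le ((nonErasing_std x).le_cut m)),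
      fun i => ?_⟩
    rw [Nat.succ_eq_add_one, ← pref_img_std, cut_std_succ_of_ne hm, pref_succ _ (_ + 2),
      occursAt_append, occursAt_singleton, length_pref]
    refine ⟨fun h => ⟨h, ?_⟩, fun h => h.1⟩
    -- The prefix ends with a letter other than `x`, and the next letter can only be `x`.
    rw [pref_succ, occursAt_append, occursAt_singleton, length_pref, img_std_cut_add_one hm] at h
    have h1 := img_std_succ_of_ne (x := x) (u := u) (i := i + (cut (std x) u m + 1))
      (by rw [h.2]; exact hm)
    rw [← cut_std_succ_of_ne hm, img_std_cut, cut_std_succ_of_ne hm]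
    exact h1

end Chain

variable {U : ℕ → ℕ → Fin 2}

/-- Along a chain of desubstitutions, the derivated words of a member belong to later members: each
desubstitution shortens the prefix, and the chain stops at the empty prefix. -/
theorem exists_toClass_eq (hU : ∀ k, U k = img (std (U k 0)) (U (k + 1)))
    (hs : ∀ k, Function.Surjective (U k)) {K : ℕ} {d : ℕ → Fin K} {n k : ℕ}
    (h : IsDerivatedWord (U k) (pref (U k) n) d) :
    ∃ j, k ≤ j ∧ (0 < n → k < j) ∧ toClass d = toClass (U j) := by
  induction n using Nat.strong_induction_on generalizing k with
  | _ n ih =>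
    rcases Nat.eq_zero_or_pos n with rfl | hn
    · exact ⟨k, le_rfl, fun h => absurd h (lt_irrefl _), (isDerivatedWord_nil (hs k)).1 h⟩
    · obtain ⟨m, hm, hocc⟩ := exists_pref_std (x := U k 0) (u := U (k + 1)) hn
      rw [← hU] at hocc
      rw [isDerivatedWord_congr hocc] at h
      have e := congrArg (fun v => IsDerivatedWord v
        (app (std (U k 0)) (pref (U (k + 1)) m) ++ [U k 0]) d) (hU k)
      obtain ⟨j, hj, -, hd⟩ := ih m hm (isDerivatedWord_std.1 (e.mp h))
      exact ⟨j, by omega, fun _ => by omega, hd⟩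

/-- Along a chain of desubstitutions, every later member is a derivated word of a given member. -/
theorem exists_isDerivatedWord (hU : ∀ k, U k = img (std (U k 0)) (U (k + 1)))
    (hs : ∀ k, Function.Surjective (U k)) (j k : ℕ) :
    ∃ n, (0 < j → 0 < n) ∧ IsDerivatedWord (U k) (pref (U k) n) (U (k + j)) := by
  induction j generalizing k with
  | zero => exact ⟨0, id, (isDerivatedWord_nil (hs k)).2 rfl⟩
  | succ j ih =>
    obtain ⟨m, -, hm⟩ := ih (k + 1)
    refine ⟨cut (std (U k 0)) (U (k + 1)) m + 1, fun _ => Nat.succ_pos _, ?_⟩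
    have h := isDerivatedWord_std (x := U k 0).2 hm
    rw [← pref_img_std, ← hU] at h
    rwa [add_right_comm, add_assoc] at h

/-- If `U 0 = φ_{s 0}(U 1)`, `U 1 = φ_{s 1}(U 2)`, …, then the derivated words of `U 0` are
`U 1, U 2, …`. -/
theorem der_eq (hU : ∀ k, U k = img (std (U k 0)) (U (k + 1)))
    (hs : ∀ k, Function.Surjective (U k)) :
    Der (U 0) = {c | ∃ j, 0 < j ∧ c = toClass (U j)} := by
  ext c
  constructor
  · rintro ⟨n, hn, K, d, hd, rfl⟩
    obtain ⟨j, -, hj, h⟩ := exists_toClass_eq hU hs hd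
    exact ⟨j, hj hn, h⟩
  · rintro ⟨j, hj, rfl⟩
    obtain ⟨n, hn, h⟩ := exists_isDerivatedWord hU hs j 0
    rw [zero_add] at h
    exact ⟨n, hn hj, 2, U j, h, rfl⟩

/-! ### Special factors and complexity -/

/-- Every letter can follow `p` in `u`. -/
def RightSpecial (u : ℕ → Fin 2) (p : List (Fin 2)) : Prop := ∀ i, p ++ [i] ∈ language u

/-- Every letter can precede `p` in `u`. -/
def LeftSpecial (u : ℕ → Fin 2) (p : List (Fin 2)) : Prop := ∀ i, i :: p ∈ language u

/-- Counting the words of length `n + 1` of a language through the words of length `n` that they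
extend by the operations `e 0` and `e 1`. -/
theorem ncard_extend {L : Set (List (Fin 2))} {e : Fin 2 → List (Fin 2) → List (Fin 2)} {n : ℕ}
    (hsurj : ∀ q, q ≠ [] → ∃ i p, q = e i p) (hlen : ∀ i p, (e i p).length = p.length + 1)
    (hinj : ∀ i j p q, e i p = e j q → i = j ∧ p = q) (hsub : ∀ i p, e i p ∈ L → p ∈ L)
    (hext : ∀ p ∈ L, p.length = n → ∃ i, e i p ∈ L) :
    {q ∈ L | q.length = n + 1}.ncard =
      {p ∈ L | p.length = n}.ncard + {p | (∀ i, e i p ∈ L) ∧ p.length = n}.ncard := by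
  have hfin : ∀ (S : Set (List (Fin 2))) (k : ℕ), (∀ p ∈ S, p.length = k) → S.Finite :=
    fun S k h => (List.finite_length_eq (Fin 2) k).subset h
  let S : Fin 2 → Set (List (Fin 2)) := fun i => {p | e i p ∈ L ∧ p.length = n}
  have hS : ∀ i, (S i).Finite := fun i => hfin _ n fun p hp => hp.2
  have h1 : {q ∈ L | q.length = n + 1} = e 0 '' S 0 ∪ e 1 '' S 1 := by
    ext q
    constructor
    · rintro ⟨hq, hq2⟩
      obtain ⟨i, p, rfl⟩ := hsurj q (by rintro rfl; simp at hq2)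
      rw [hlen] at hq2
      have hp : p ∈ S i := ⟨hq, by omega⟩
      fin_cases i
      · exact Or.inl ⟨p, hp, rfl⟩
      · exact Or.inr ⟨p, hp, rfl⟩
    · rintro (⟨p, hp, rfl⟩ | ⟨p, hp, rfl⟩)
      · exact ⟨hp.1, by rw [hlen, hp.2]⟩
      · exact ⟨hp.1, by rw [hlen, hp.2]⟩
  have h2 : {p ∈ L | p.length = n} = S 0 ∪ S 1 := by
    ext p
    constructor
    · rintro ⟨hp, hp2⟩
      obtain ⟨i, hi⟩ := hext p hp hp2
      fin_cases i
      · exact Or.inl ⟨hi, hp2⟩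
      · exact Or.inr ⟨hi, hp2⟩
    · rintro (hp | hp)
      · exact ⟨hsub _ _ hp.1, hp.2⟩
      · exact ⟨hsub _ _ hp.1, hp.2⟩
  have h3 : {p | (∀ i, e i p ∈ L) ∧ p.length = n} = S 0 ∩ S 1 := by
    ext p
    simp only [S, Fin.forall_fin_two, Set.mem_ofPred_eq, Set.mem_inter_iff]
    tauto
  rw [h1, h2, h3, Set.ncard_union_add_ncard_inter _ _ (hS 0) (hS 1),
    Set.ncard_union_eq ?_ ((hS 0).image _) ((hS 1).image _),
    Set.ncard_image_of_injective _ fun p q h => (hinj _ _ _ _ h).2,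
    Set.ncard_image_of_injective _ fun p q h => (hinj _ _ _ _ h).2]
  rw [Set.disjoint_left]
  rintro _ ⟨p, -, rfl⟩ ⟨q, -, h⟩
  simpa using (hinj _ _ _ _ h).1

theorem ncard_language_succ (u : ℕ → Fin 2) (n : ℕ) :
    {q ∈ language u | q.length = n + 1}.ncard =
      {p ∈ language u | p.length = n}.ncard + {p | RightSpecial u p ∧ p.length = n}.ncard := by
  refine ncard_extend (e := fun i p => p ++ [i]) (fun q hq => ?_) (by simp) (fun i j p q h => ?_)
    (fun i p h => language_of_infix (List.prefix_append _ _).isInfix h) ?_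
  · exact ⟨_, _, (List.dropLast_append_getLast hq).symm⟩
  · have := List.append_inj' h rfl
    exact ⟨by simpa using this.2, this.1⟩
  · rintro p ⟨i, hi⟩ -
    exact ⟨u (i + p.length), i, occursAt_append.2 ⟨hi, occursAt_singleton.2 rfl⟩⟩

/-- A binary word is Sturmian when it has exactly one right special factor of each length, since the
right special factors of length `n` count the increase of the complexity at `n`. -/
theorem isSturmian_iff {u : ℕ → Fin 2} :
    IsSturmian u ↔ ∀ n, ∃! p, RightSpecial u p ∧ p.length = n := by
  have h : (∀ n, ∃! p, RightSpecial u p ∧ p.length = n) ↔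
      ∀ n, {p | RightSpecial u p ∧ p.length = n}.ncard = 1 := by
    simp only [Set.ncard_eq_one, Set.eq_singleton_iff_unique_mem, ExistsUnique,
      Set.mem_ofPred_eq]
  rw [h]
  constructor
  · intro hu n
    have := ncard_language_succ u n
    rw [hu, hu] at this
    omega
  · intro hu n
    induction n with
    | zero =>
      rw [Set.ncard_eq_one]
      refine ⟨[], ?_⟩
      ext p
      simp only [Set.mem_ofPred_eq, List.length_eq_zero_iff, Set.mem_singleton_iff,
        and_iff_right_iff_imp]
      rintro rfl
      exact ⟨0, rfl⟩
    | succ n ih => rw [ncard_language_succ, ih, hu]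

theorem RightSpecial.suffix {u : ℕ → Fin 2} {p q : List (Fin 2)} (hq : RightSpecial u q)
    (h : p <:+ q) : RightSpecial u p := by
  intro i
  obtain ⟨s, rfl⟩ := h
  refine language_of_infix (List.IsSuffix.isInfix ⟨s, ?_⟩) (hq i)
  simp

theorem LeftSpecial.prefix {u : ℕ → Fin 2} {p q : List (Fin 2)} (hq : LeftSpecial u q)
    (h : p <+: q) : LeftSpecial u p := by
  intro i
  obtain ⟨s, rfl⟩ := h
  exact language_of_infix (List.IsPrefix.isInfix ⟨s, rfl⟩) (hq i)

theorem IsSturmian.surjective {u : ℕ → Fin 2} (hu : IsSturmian u) : Function.Surjective u := by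
  obtain ⟨p, ⟨hp, hp2⟩, -⟩ := isSturmian_iff.1 hu 0
  rw [List.length_eq_zero_iff] at hp2
  subst hp2
  intro i
  obtain ⟨j, hj⟩ := hp i
  exact ⟨j, occursAt_singleton.1 hj⟩

theorem IsSturmian.not_periodic {u : ℕ → Fin 2} (hu : IsSturmian u) {m : ℕ}
    (h : (fun i => u (m + i)) = u) : m = 0 := by
  by_contra hm
  have hper : Function.Periodic u m := fun i => by rw [add_comm]; exact congrFun h i
  have h1 : {p ∈ language u | p.length = m} ⊆ (fun i => factorAt u i m) '' Set.Iio m := by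
    rintro p ⟨⟨i, hi⟩, rfl⟩
    refine ⟨i % p.length, Nat.mod_lt _ (Nat.pos_of_ne_zero hm), ?_⟩
    conv_rhs => rw [← show factorAt u i p.length = p from hi]
    simp only [factorAt]
    refine List.map_congr_left fun j _ => ?_
    rw [← hper.map_mod_nat, Nat.mod_add_mod, hper.map_mod_nat]
  have h2 := Set.ncard_le_ncard h1 ((Set.finite_Iio m).image _)
  have h3 := Set.ncard_image_le (f := fun i => factorAt u i m) (Set.finite_Iio m)
  rw [hu m] at h2
  have h4 : (Set.Iio m).ncard = m := by
    rw [Set.ncard_eq_toFinset_card']; simp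
  omega

theorem isStandardSturmian_iff {u : ℕ → Fin 2} :
    IsStandardSturmian u ↔ IsSturmian u ∧ ∀ n, LeftSpecial u (pref u n) := by
  refine and_congr_right fun _ => forall_congr' fun n => ⟨?_, fun h => ⟨0, 1, by decide, h 0, h 1⟩⟩
  rintro ⟨x, y, hxy, hx, hy⟩ i
  by_cases h : i = x
  · exact h ▸ hx
  · rwa [show i = y from fin_two_eq_of_ne h (Ne.symm hxy)]

/-- The prefixes of a standard Sturmian word are its only left special factors. -/
theorem IsStandardSturmian.eq_pref {u : ℕ → Fin 2} (hu : IsStandardSturmian u)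
    {p : List (Fin 2)} (hp : LeftSpecial u p) : p = pref u p.length := by
  have hpre := (isStandardSturmian_iff.1 hu).2
  have h1 := ncard_extend (L := language u) (e := fun i p => i :: p) (n := p.length)
    (fun q hq => by
      cases q with
      | nil => exact absurd rfl hq
      | cons i q => exact ⟨i, q, rfl⟩) (by simp)
    (fun i j p q h => by simpa using h)
    (fun i p h => language_of_infix (List.suffix_cons _ _).isInfix h)
    (by
      rintro q ⟨i, hi⟩ -
      cases i with
      | zero =>
        refine ⟨0, ?_⟩
        rw [← show factorAt u 0 q.length = q from hi]
        exact hpre q.length 0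
      | succ i => exact ⟨u i, i, occursAt_cons.2 ⟨rfl, hi⟩⟩)
  rw [hu.1, hu.1] at h1
  have h2 : {q | (∀ i, i :: q ∈ language u) ∧ q.length = p.length}.ncard = 1 := by omega
  obtain ⟨q, hq⟩ := Set.ncard_eq_one.1 h2
  have h3 : p ∈ ({q} : Set _) := hq ▸ ⟨hp, rfl⟩
  have h4 : pref u p.length ∈ ({q} : Set _) := hq ▸ ⟨hpre _, by simp⟩
  exact h3.trans h4.symm

/-! ### The morphisms `std x` preserve Sturmian and standard Sturmian words -/

section Preserve

variable {x : Fin 2} {u : ℕ → Fin 2}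

theorem RightSpecial.img_std {p : List (Fin 2)} (hp : RightSpecial u p) :
    RightSpecial (img (std x) u) (app (std x) p ++ [x]) := by
  intro i
  have h := app_std_mem_language_iff (x := x).2 (hp i)
  rw [app_append, app_std] at h
  split_ifs at h with hi
  · rwa [hi]
  · refine language_of_infix (List.IsPrefix.isInfix ⟨[x], ?_⟩) h
    simp

theorem mem_language_std_iff {p : List (Fin 2)} {i : Fin 2} :
    app (std x) p ++ [x] ++ [i] ∈ language (img (std x) u) ↔ p ++ [i] ∈ language u := by
  by_cases hi : i = x
  · subst hi
    rw [← app_std_mem_language_iff (x := i) (l := p ++ [i]), app_append, app_std_self]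
  · rw [← app_std_mem_language_iff (x := x) (l := p ++ [i]), app_append, app_std_of_ne hi]
    constructor
    · rintro ⟨j, hj⟩
      refine ⟨j, ?_⟩
      have h1 : app (std x) p ++ [x, i] = app (std x) p ++ [x] ++ [i] := by simp
      rw [h1, occursAt_append]
      refine ⟨hj, occursAt_singleton.2 ?_⟩
      -- The letter `i ≠ x` is always followed by `x`.
      have h2 := occursAt_singleton.1 (occursAt_append.1 hj).2
      have h3 := img_std_succ_of_ne (x := x) (u := u) (h2.symm ▸ hi)
      refine Eq.trans (congrArg _ ?_) h3
      simp only [List.length_append, List.length_cons, List.length_nil]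
      omega
    · intro h
      refine language_of_infix (List.IsPrefix.isInfix ⟨[x], ?_⟩) h
      simp

/-- Right special factors of `φ(u)` come from right special factors of `u`. -/
theorem RightSpecial.exists_of_std {p : List (Fin 2)} (hp : RightSpecial (img (std x) u) p)
    (hne : p ≠ []) : ∃ q, RightSpecial u q ∧ p <:+ app (std x) q ++ [x] := by
  -- Extend `p` to the left by one letter, if necessary, so that it starts with `x`.
  obtain ⟨p', hp', hsuf, l, rfl⟩ : ∃ p', RightSpecial (img (std x) u) p' ∧ p <:+ p' ∧
      ∃ l, p' = x :: l := by
    obtain ⟨y, l, rfl⟩ := List.exists_cons_of_ne_nil hne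
    by_cases hy : y = x
    · exact ⟨_, hp, List.suffix_rfl, l, by rw [hy]⟩
    · refine ⟨x :: y :: l, fun i => ?_, List.suffix_cons _ _, _, rfl⟩
      obtain ⟨j, hj⟩ := hp i
      rw [List.cons_append, occursAt_cons] at hj
      obtain ⟨k, rfl, hk⟩ := img_std_pred_of_ne (x := x) (u := u) (hj.1.symm ▸ hy)
      exact ⟨k, occursAt_cons.2 ⟨hk, occursAt_cons.2 hj⟩⟩
  obtain ⟨p, hpl⟩ : ∃ p, p ++ [x] = x :: l := by
    have h1 := List.dropLast_append_getLast (List.cons_ne_nil x l)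
    have h2 : (x :: l).getLast (List.cons_ne_nil x l) = x := by
      by_contra h2
      -- A letter other than `x` is followed by `x` only.
      obtain ⟨z, hz⟩ : ∃ z : Fin 2, z ≠ x := ⟨x + 1, by omega⟩
      obtain ⟨j, hj⟩ := hp' z
      rw [← h1, occursAt_append] at hj
      have h3 := occursAt_singleton.1 (occursAt_append.1 hj.1).2
      have h4 := img_std_succ_of_ne (x := x) (u := u) (h3.symm ▸ h2)
      have h5 := occursAt_singleton.1 hj.2
      rw [List.length_append, List.length_singleton, ← add_assoc] at h5
      exact hz (h5.symm.trans h4)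
    rw [h2] at h1
    exact ⟨_, h1⟩
  obtain ⟨j, hj⟩ := hp' x
  rw [List.cons_append, occursAt_cons] at hj
  obtain ⟨n, rfl⟩ := exists_cut_std_of_eq hj.1
  rw [← occursAt_cons, ← List.cons_append, ← hpl] at hj
  have hj1 := occursAt_append.1 (occursAt_append.1 hj).1
  obtain ⟨m, hm⟩ := exists_cut_std_of_eq (occursAt_singleton.1 hj1.2)
  have hnm : n ≤ m := (nonErasing_std x).cut_strictMono.le_iff_le.1 (hm ▸ Nat.le_add_right _ _)
  have hp2 : p = app (std x) (factorAt u n (m - n)) := by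
    rw [← factorAt_cut_std hnm, ← hm, Nat.add_sub_cancel_left]
    exact hj1.1.symm
  refine ⟨factorAt u n (m - n), fun i => ?_, ?_⟩
  · rw [← mem_language_std_iff (x := x), ← hp2, hpl]
    exact hp' i
  · rw [← hp2, hpl]
    exact hsuf

theorem IsSturmian.img_std (hu : IsSturmian u) (x : Fin 2) : IsSturmian (img (std x) u) := by
  rw [isSturmian_iff] at hu ⊢
  have huniq : ∀ p q, RightSpecial u p → RightSpecial u q → p.length ≤ q.length → p <:+ q := by
    intro p q hp hq hpq
    have h1 : (q.drop (q.length - p.length)) <:+ q := List.drop_suffix _ _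
    have h2 := (hu p.length).unique ⟨hp, rfl⟩ ⟨hq.suffix h1, by simp; omega⟩
    rwa [← h2] at h1
  have hmono : ∀ p q : List (Fin 2), p <:+ q →
      app (std x) p ++ [x] <:+ app (std x) q ++ [x] := by
    rintro p _ ⟨s, rfl⟩
    exact ⟨app (std x) s, by simp [app_append]⟩
  intro n
  refine existsUnique_of_exists_of_unique ?_ ?_
  · obtain ⟨p, ⟨hp, hpn⟩, -⟩ := hu n
    have h1 := (nonErasing_std x).length_le p
    refine ⟨_, hp.img_std.suffix (List.drop_suffix
      ((app (std x) p ++ [x]).length - n) _), ?_⟩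
    rw [List.length_drop, List.length_append]
    omega
  · rintro p q ⟨hp, hpn⟩ ⟨hq, hqn⟩
    rcases Nat.eq_zero_or_pos n with rfl | hn
    · rw [List.length_eq_zero_iff] at hpn hqn
      rw [hpn, hqn]
    · obtain ⟨p', hp', hpp⟩ := hp.exists_of_std (List.ne_nil_of_length_pos (hpn ▸ hn))
      obtain ⟨q', hq', hqq⟩ := hq.exists_of_std (List.ne_nil_of_length_pos (hqn ▸ hn))
      have key : ∀ r, p <:+ r → q <:+ r → p = q := fun r h1 h2 =>
        (List.suffix_of_suffix_length_le h1 h2 (by omega)).eq_of_length (by omega)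
      rcases le_total p'.length q'.length with h | h
      · exact key _ (hpp.trans (hmono _ _ (huniq _ _ hp' hq' h))) hqq
      · exact key _ hpp (hqq.trans (hmono _ _ (huniq _ _ hq' hp' h)))

theorem IsStandardSturmian.img_std (hu : IsStandardSturmian u) (x : Fin 2) :
    IsStandardSturmian (img (std x) u) := by
  rw [isStandardSturmian_iff] at hu ⊢
  refine ⟨hu.1.img_std x, fun n => ?_⟩
  have h1 : LeftSpecial (img (std x) u) (app (std x) (pref u n)) := by
    intro i
    have h := app_std_mem_language_iff (x := x).2 (hu.2 n i)
    refine language_of_infix ?_ h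
    rw [app_cons, app_std]
    split_ifs with hi
    · exact ⟨[], [x], by simp [hi]⟩
    · exact ⟨[x], [x], by simp⟩
  refine h1.prefix ?_
  rw [← pref_img (nonErasing_std x)]
  obtain ⟨k, hk⟩ := Nat.exists_eq_add_of_le ((nonErasing_std x).le_cut (u := u) n)
  rw [hk, pref_add]
  exact List.prefix_append _ _

end Preserve

/-! ### Renaming the letters -/

/-- The morphism renaming the letters by `σ`. -/
def ren (σ : Equiv.Perm (Fin 2)) : Morphism := FreeMonoid.lift fun y => FreeMonoid.of (σ y)

theorem app_ren (σ : Equiv.Perm (Fin 2)) (l : List (Fin 2)) : app (ren σ) l = l.map σ := by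
  induction l with
  | nil => simp
  | cons y l ih =>
    rw [app_cons, ih, ren, app_lift]
    rfl

theorem nonErasing_ren (σ : Equiv.Perm (Fin 2)) : NonErasing (ren σ) := by
  simp [NonErasing, app_ren]

theorem ren_one : ren 1 = 1 := morphism_ext fun i => by simp [app_ren]

theorem ren_mul (σ τ : Equiv.Perm (Fin 2)) : ren (σ * τ) = ren σ * ren τ :=
  morphism_ext fun i => by simp [app_mul, app_ren]

theorem E_eq : E = ren (Equiv.swap 0 1) := by
  refine morphism_ext fun i => ?_
  rw [app_ren, E, mkMorphism, app_lift]
  fin_cases i <;> rfl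

theorem ren_mul_std (σ : Equiv.Perm (Fin 2)) (x : Fin 2) :
    ren σ * std x = std (σ x) * ren σ := by
  refine morphism_ext fun i => ?_
  by_cases h : i = x <;> simp [app_mul, app_ren, app_std, h]

theorem map_factorAt (σ : Fin 2 → Fin 2) (u : ℕ → Fin 2) (i n : ℕ) :
    (factorAt u i n).map σ = factorAt (σ ∘ u) i n := by
  simp [factorAt]

theorem img_ren (σ : Equiv.Perm (Fin 2)) (u : ℕ → Fin 2) : img (ren σ) u = σ ∘ u := by
  refine ((isImage_iff_eq (nonErasing_ren σ)).1 (isImage_iff.2 ⟨fun n => ?_, fun N =>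
    ⟨N, (nonErasing_ren σ).le_cut N⟩⟩)).symm
  rw [cut, app_ren, List.length_map, length_pref]
  exact map_factorAt _ _ _ _

theorem language_comp (σ : Equiv.Perm (Fin 2)) (u : ℕ → Fin 2) :
    language (σ ∘ u) = List.map σ '' language u := by
  ext p
  constructor
  · rintro ⟨i, hi⟩
    exact ⟨_, factorAt_mem_language i p.length, (map_factorAt _ _ _ _).trans hi⟩
  · rintro ⟨p, ⟨i, hi⟩, rfl⟩
    refine ⟨i, ?_⟩
    rw [OccursAt, List.length_map, ← map_factorAt, hi]

theorem IsSturmian.comp {u : ℕ → Fin 2} (hu : IsSturmian u) (σ : Equiv.Perm (Fin 2)) :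
    IsSturmian (σ ∘ u) := by
  intro n
  have h : {p ∈ language (σ ∘ u) | p.length = n} =
      List.map σ '' {p ∈ language u | p.length = n} := by
    rw [language_comp]
    ext p
    constructor
    · rintro ⟨⟨q, hq, rfl⟩, h⟩
      exact ⟨q, ⟨hq, by simpa using h⟩, rfl⟩
    · rintro ⟨q, ⟨hq, h⟩, rfl⟩
      exact ⟨⟨q, hq, rfl⟩, by simpa using h⟩
  rw [h, Set.ncard_image_of_injective _ (List.map_injective_iff.2 σ.injective), hu n]

theorem IsStandardSturmian.comp {u : ℕ → Fin 2} (hu : IsStandardSturmian u)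
    (σ : Equiv.Perm (Fin 2)) : IsStandardSturmian (σ ∘ u) := by
  rw [isStandardSturmian_iff] at hu ⊢
  refine ⟨hu.1.comp σ, fun n i => ?_⟩
  rw [language_comp]
  exact ⟨_, hu.2 n (σ.symm i), by simp [pref, map_factorAt]⟩

/-! ### Compositions of elementary standard morphisms -/

/-- The composition of the morphisms `std x` for `x` in a word. -/
def stdProd (l : List (Fin 2)) : Morphism := (l.map std).prod

@[simp] theorem stdProd_nil : stdProd [] = 1 := rfl

theorem stdProd_cons (x : Fin 2) (l : List (Fin 2)) : stdProd (x :: l) = std x * stdProd l := by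
  simp [stdProd]

theorem stdProd_append (l m : List (Fin 2)) : stdProd (l ++ m) = stdProd l * stdProd m := by
  simp [stdProd]

theorem ren_mul_stdProd (σ : Equiv.Perm (Fin 2)) (l : List (Fin 2)) :
    ren σ * stdProd l = stdProd (l.map σ) * ren σ := by
  induction l with
  | nil => simp
  | cons x l ih =>
    rw [List.map_cons, stdProd_cons, stdProd_cons, ← mul_assoc, ren_mul_std, mul_assoc, ih,
      mul_assoc]

theorem nonErasing_stdProd (l : List (Fin 2)) : NonErasing (stdProd l) := by
  induction l with
  | nil => exact nonErasing_one
  | cons x l ih => rw [stdProd_cons]; exact (nonErasing_std x).mul ih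

theorem img_stdProd_cons (x : Fin 2) (l : List (Fin 2)) (u : ℕ → Fin 2) :
    img (stdProd (x :: l)) u = img (std x) (img (stdProd l) u) := by
  rw [stdProd_cons, img_mul (nonErasing_stdProd l) (nonErasing_std x)]

theorem IsSturmian.img_stdProd {u : ℕ → Fin 2} (hu : IsSturmian u) (l : List (Fin 2)) :
    IsSturmian (img (stdProd l) u) := by
  induction l with
  | nil => simpa using hu
  | cons x l ih => rw [img_stdProd_cons]; exact ih.img_std x

theorem IsStandardSturmian.img_stdProd {u : ℕ → Fin 2} (hu : IsStandardSturmian u)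
    (l : List (Fin 2)) : IsStandardSturmian (img (stdProd l) u) := by
  induction l with
  | nil => simpa using hu
  | cons x l ih => rw [img_stdProd_cons]; exact ih.img_std x

theorem nonErasing_stdProd_mul_ren (l : List (Fin 2)) (σ : Equiv.Perm (Fin 2)) :
    NonErasing (stdProd l * ren σ) :=
  (nonErasing_stdProd l).mul (nonErasing_ren σ)

theorem img_stdProd_mul_ren (l : List (Fin 2)) (σ : Equiv.Perm (Fin 2)) (u : ℕ → Fin 2) :
    img (stdProd l * ren σ) u = img (stdProd l) (σ ∘ u) := by
  rw [img_mul (nonErasing_ren σ) (nonErasing_stdProd l), img_ren]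

theorem isSturmianMorphism_stdProd_mul_ren (l : List (Fin 2)) (σ : Equiv.Perm (Fin 2)) :
    IsSturmianMorphism (stdProd l * ren σ) := fun u hu =>
  ⟨_, isImage_img (nonErasing_stdProd_mul_ren l σ), by
    rw [img_stdProd_mul_ren]; exact (hu.comp σ).img_stdProd l⟩

/-! ### Fixed points of standard morphisms -/

/-- The morphism `x ↦ x`, `y ↦ yx` for `y ≠ x`; it is `φ_a` for `x = 0` and `φ_α` for `x = 1`. -/
def conj (x : Fin 2) : Morphism :=
  FreeMonoid.lift fun y => FreeMonoid.ofList (if y = x then [x] else [y, x])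

theorem app_conj (x y : Fin 2) : app (conj x) [y] = if y = x then [x] else [y, x] :=
  app_lift _ y

theorem nonErasing_conj (x : Fin 2) : NonErasing (conj x) := by
  intro y
  rw [app_conj]
  split_ifs <;> simp

/-- The morphisms `conj x` and `std x` are conjugate by the letter `x`. -/
theorem cons_app_conj (x : Fin 2) (l : List (Fin 2)) :
    x :: app (conj x) l = app (std x) l ++ [x] := by
  induction l with
  | nil => simp
  | cons y l ih =>
    rw [app_cons, app_cons (std x), List.append_assoc, ← ih, app_conj, app_std]
    split_ifs <;> simp

theorem img_conj (x : Fin 2) (u : ℕ → Fin 2) :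
    img (conj x) u = fun i => img (std x) u (1 + i) := by
  refine ((isImage_iff_eq (nonErasing_conj x)).1 (isImage_iff.2 ⟨fun n => ?_, fun N =>
    ⟨N, (nonErasing_conj x).le_cut N⟩⟩)).symm
  have h1 := cons_app_conj x (pref u n)
  have h2 : cut (conj x) u n = cut (std x) u n := by
    simpa [cut] using congrArg List.length h1
  rw [← pref_img_std, pref.eq_1 (img _ _), factorAt_succ, zero_add] at h1
  rw [(List.cons.inj h1).2, h2]
  simp [pref, factorAt]

/-- The letter `x` such that an elementary morphism is `std x` or `conj x`. -/
def Gen.letter : Gen → Fin 2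
  | .a => 0
  | .b => 0
  | .α => 1
  | .β => 1

/-- The name of the elementary morphism `std x`. -/
def stdGen (x : Fin 2) : Gen := if x = 0 then .b else .β

theorem elem_eq (g : Gen) :
    (g = stdGen g.letter ∧ elem g = std g.letter) ∨ elem g = conj g.letter := by
  cases g
  · refine Or.inr (morphism_ext fun i => ?_)
    rw [elem, mkMorphism, app_lift, app_conj]
    fin_cases i <;> rfl
  · refine Or.inl ⟨rfl, morphism_ext fun i => ?_⟩
    rw [elem, mkMorphism, app_lift, app_std]
    fin_cases i <;> rfl
  · refine Or.inr (morphism_ext fun i => ?_)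
    rw [elem, mkMorphism, app_lift, app_conj]
    fin_cases i <;> rfl
  · refine Or.inl ⟨rfl, morphism_ext fun i => ?_⟩
    rw [elem, mkMorphism, app_lift, app_std]
    fin_cases i <;> rfl

theorem elem_stdGen (x : Fin 2) : elem (stdGen x) = std x := by
  refine morphism_ext fun i => ?_
  fin_cases x <;> · rw [app_std]; fin_cases i <;> rfl

theorem phi_cons (g : Gen) (w : List Gen) : phi (g :: w) = elem g * phi w := by
  simp [phi]

theorem phi_map_stdGen (l : List (Fin 2)) : phi (l.map stdGen) = stdProd l := by
  rw [phi, stdProd, List.map_map]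
  congr 2
  funext x
  exact elem_stdGen x

theorem nonErasing_phi (w : List Gen) : NonErasing (phi w) := by
  induction w with
  | nil => exact nonErasing_one
  | cons g w ih =>
    rw [phi_cons]
    refine NonErasing.mul ?_ ih
    rcases elem_eq g with ⟨-, h⟩ | h <;> rw [h]
    · exact nonErasing_std _
    · exact nonErasing_conj _

/-- Replacing `a` by `b` and `α` by `β` in `w` changes the image of a word under `φ_w` only by a
shift, which is not trivial as soon as `a` or `α` occurs in `w`. -/
theorem exists_img_phi_eq_drop (w : List Gen) (u : ℕ → Fin 2) :
    ∃ m, (img (phi w) u = fun i => img (stdProd (w.map Gen.letter)) u (m + i)) ∧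
      (m = 0 → w = (w.map Gen.letter).map stdGen) := by
  induction w with
  | nil => exact ⟨0, by simp [phi], fun _ => rfl⟩
  | cons g w ih =>
    obtain ⟨m, h1, h2⟩ := ih
    have hle := (nonErasing_std g.letter).le_cut
      (u := img (stdProd (w.map Gen.letter)) u) m
    rw [phi_cons, List.map_cons, img_stdProd_cons]
    rcases elem_eq g with ⟨hg, h⟩ | h
    · refine ⟨cut (std g.letter) (img (stdProd (w.map Gen.letter)) u) m, ?_, fun h0 => ?_⟩
      · rw [img_mul (nonErasing_phi w) (h ▸ nonErasing_std _), h, h1, img_drop (nonErasing_std _)]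
      · rw [List.map_cons, ← hg, ← h2 (by omega)]
    · refine ⟨1 + cut (conj g.letter) (img (stdProd (w.map Gen.letter)) u) m, ?_,
        fun h0 => by omega⟩
      rw [img_mul (nonErasing_phi w) (h ▸ nonErasing_conj _), h, h1, img_drop (nonErasing_conj _),
        img_conj]
      funext i
      simp only [add_assoc]

/-- Only `b` and `β` occur in the name of a morphism fixing a standard Sturmian word. -/
theorem IsStandardSturmian.eq_map_stdGen {c : ℕ → Fin 2} (hc : IsStandardSturmian c)
    {w : List Gen} {ε : Equiv.Perm (Fin 2)} (h : c = img (phi w * ren ε) c) :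
    w = (w.map Gen.letter).map stdGen := by
  obtain ⟨m, h1, h2⟩ := exists_img_phi_eq_drop w (ε ∘ c)
  set d := img (stdProd (w.map Gen.letter)) (ε ∘ c) with hd
  rw [img_mul (nonErasing_ren ε) (nonErasing_phi w), img_ren, h1] at h
  have hds : IsStandardSturmian d := (hc.comp ε).img_stdProd _
  -- The prefixes of the shifted word `c` are left special in `d`, hence prefixes of `d`.
  have hcd : c = d := by
    refine eq_of_pref_eq fun n => ?_
    have h3 : LeftSpecial d (pref c n) := by
      intro i
      obtain ⟨j, hj⟩ := (isStandardSturmian_iff.1 hc).2 n i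
      refine ⟨m + j, ?_⟩
      have h4 : ∀ k, factorAt d (m + j) k = factorAt c j k := fun k =>
        List.map_congr_left fun t _ => by rw [congrFun h, add_assoc]
      rw [OccursAt, h4]
      exact hj
    simpa using hds.eq_pref h3
  exact h2 (hds.1.not_periodic (h.symm.trans hcd))

/-- A morphism whose images of letters start with the same letter `x` has at most one fixed point,
if one of its fixed points contains a letter other than `x`. -/
theorem fixedPoint_unique {ψ : Morphism} {x : Fin 2} (hψ : ∀ i, ∃ l, app ψ [i] = x :: l)
    {c u : ℕ → Fin 2} (hc : c = img ψ c) (hsurj : Function.Surjective c) (hu : u = img ψ u) :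
    u = c := by
  have hne : NonErasing ψ := fun i h => by
    obtain ⟨l, hl⟩ := hψ i
    rw [hl] at h
    exact List.cons_ne_nil _ _ h
  have hhead : ∀ v : ℕ → Fin 2, v = img ψ v → ∀ n, v (cut ψ v n) = x := by
    intro v hv n
    have h1 := occursAt_img hne (occursAt_singleton.2 (rfl : v n = v n))
    obtain ⟨l, hl⟩ := hψ (v n)
    rw [hl, ← hv] at h1
    exact (occursAt_cons.1 h1).1
  have hx : 2 ≤ (app ψ [x]).length := by
    by_contra hlt
    have hone : (app ψ [x]).length = 1 := by
      have := List.length_pos_of_ne_nil (hne x)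
      omega
    -- Otherwise `x` is fixed, and the fixed point `c` is constant.
    have h1 : ∀ k, cut ψ c k = k := by
      intro k
      induction k with
      | zero => exact cut_zero _ _
      | succ k ih =>
        have h2 := hhead c hc k
        rw [ih] at h2
        rw [cut_succ, h2, hone, ih]
    obtain ⟨k, hk⟩ := hsurj (x + 1)
    have h2 := hhead c hc k
    rw [h1, hk] at h2
    omega
  have hzero : ∀ v : ℕ → Fin 2, v = img ψ v → v 0 = x := fun v hv => by
    have := hhead v hv 0
    rwa [cut_zero] at this
  have hpref : ∀ v : ℕ → Fin 2, v = img ψ v → ∀ n, pref v (cut ψ v n) = app ψ (pref v n) :=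
    fun v hv n => by
      have h1 := pref_img hne (u := v) n
      rwa [← hv] at h1
  refine eq_of_pref_eq fun n => ?_
  induction n with
  | zero => rfl
  | succ n ih =>
    rcases Nat.eq_zero_or_pos n with rfl | hn
    · rw [pref_succ, pref_succ, ih, hzero u hu, hzero c hc]
    · have h1 : pref u (cut ψ u n) = pref c (cut ψ c n) := by
        rw [hpref u hu, hpref c hc, ih]
      have h2 : cut ψ u n = cut ψ c n := by rw [cut, ih, cut]
      rw [h2] at h1
      refine pref_eq_of_le ?_ h1
      obtain ⟨k, rfl⟩ := Nat.exists_eq_add_of_le (Nat.succ_le_of_lt hn)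
      have h3 := hne.length_le (factorAt c 1 k)
      have h4 := cut_add ψ c 1 k
      have h5 := cut_succ ψ c 0
      rw [cut_zero, hzero c hc] at h5
      simp only [Nat.succ_eq_add_one, zero_add] at *
      rw [length_factorAt] at h3
      omega

theorem exists_app_stdProd_cons (x : Fin 2) (l : List (Fin 2)) (ε : Equiv.Perm (Fin 2))
    (i : Fin 2) : ∃ m, app (stdProd (x :: l) * ren ε) [i] = x :: m := by
  rw [stdProd_cons, mul_assoc, app_mul]
  obtain ⟨y, m, h⟩ := List.exists_cons_of_ne_nil (nonErasing_stdProd_mul_ren l ε i)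
  rw [h, app_cons, app_std]
  split_ifs <;> exact ⟨_, rfl⟩

/-! ### Desubstitution of a fixed point -/

/-- The cyclic shift that applies `ε` to the letter moved to the end. -/
def twistedCyc (ε : Equiv.Perm (Fin 2)) : List (Fin 2) → List (Fin 2)
  | [] => []
  | x :: l => l ++ [ε x]

/-- A fixed point `u` of `stdProd l * ren ε` satisfies `u = std x (v)`, where `x` is the first
letter of `l`; the desubstituted word `v` is paired with the name of a morphism fixing it. -/
def desubst (ε : Equiv.Perm (Fin 2)) (s : List (Fin 2) × (ℕ → Fin 2)) :
    List (Fin 2) × (ℕ → Fin 2) :=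
  (twistedCyc ε s.1, img (stdProd s.1.tail) (ε ∘ s.2))

theorem comp_img_std (ε : Equiv.Perm (Fin 2)) (x : Fin 2) (u : ℕ → Fin 2) :
    ε ∘ img (std x) u = img (std (ε x)) (ε ∘ u) := by
  rw [← img_ren, ← img_ren, ← img_mul (nonErasing_std x) (nonErasing_ren ε), ren_mul_std,
    img_mul (nonErasing_ren ε) (nonErasing_std _)]

theorem img_stdProd_append (l m : List (Fin 2)) (u : ℕ → Fin 2) :
    img (stdProd (l ++ m)) u = img (stdProd l) (img (stdProd m) u) := by
  rw [stdProd_append, img_mul (nonErasing_stdProd m) (nonErasing_stdProd l)]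

theorem stdProd_singleton (x : Fin 2) : stdProd [x] = std x := by simp [stdProd]

section Desubst

variable {ε : Equiv.Perm (Fin 2)} {x : Fin 2} {l : List (Fin 2)} {u : ℕ → Fin 2}

theorem img_desubst (h : u = img (stdProd (x :: l)) (ε ∘ u)) :
    u = img (std x) (desubst ε (x :: l, u)).2 :=
  h.trans (img_stdProd_cons x l _)

theorem comp_desubst (h : u = img (stdProd (x :: l)) (ε ∘ u)) :
    ε ∘ u = img (stdProd [ε x]) (ε ∘ (desubst ε (x :: l, u)).2) := by
  rw [stdProd_singleton, ← comp_img_std, ← img_desubst h]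

theorem img_std_apply_zero (x : Fin 2) (u : ℕ → Fin 2) : img (std x) u 0 = x := by
  have := img_std_cut (x := x) (u := u) 0
  rwa [cut_zero] at this

/-- The desubstituted word is fixed by the morphism with the shifted name. -/
theorem desubst_fixed (h : u = img (stdProd (x :: l)) (ε ∘ u)) :
    (desubst ε (x :: l, u)).2 =
      img (stdProd (l ++ [ε x])) (ε ∘ (desubst ε (x :: l, u)).2) := by
  rw [img_stdProd_append, ← comp_desubst h]
  rfl

/-- Desubstituting along the prefix `p` of the name `p ++ q` of the morphism fixing `u`. -/
theorem desubst_iterate (p q : List (Fin 2)) (u : ℕ → Fin 2)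
    (h : u = img (stdProd (p ++ q)) (ε ∘ u)) :
    (desubst ε)^[p.length] (p ++ q, u) = (q ++ p.map ε, img (stdProd q) (ε ∘ u)) := by
  induction p generalizing q u with
  | nil => simpa using h
  | cons x p ih =>
    have h1 : (desubst ε (x :: p ++ q, u)).2 = img (stdProd (p ++ (q ++ [ε x])))
        (ε ∘ (desubst ε (x :: p ++ q, u)).2) := by
      rw [← List.append_assoc]
      exact desubst_fixed h
    rw [List.length_cons, Function.iterate_succ_apply]
    have h2 : desubst ε (x :: p ++ q, u) =
        (p ++ (q ++ [ε x]), (desubst ε (x :: p ++ q, u)).2) := by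
      rw [← List.append_assoc]; rfl
    rw [h2, ih _ _ h1, img_stdProd_append]
    have h3 : ε ∘ u = img (stdProd [ε x]) (ε ∘ (desubst ε (x :: p ++ q, u)).2) := comp_desubst h
    rw [← h3]
    simp

/-- The name of the morphism fixing `u` is read off the first letters of the desubstituted words. -/
theorem eq_map_desubst (p q : List (Fin 2)) (u : ℕ → Fin 2)
    (h : u = img (stdProd (p ++ q)) (ε ∘ u)) :
    p = (List.range p.length).map fun i => ((desubst ε)^[i] (p ++ q, u)).2 0 := by
  induction p generalizing q u with
  | nil => simp
  | cons x p ih =>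
    have h1 : (desubst ε (x :: p ++ q, u)).2 = img (stdProd (p ++ (q ++ [ε x])))
        (ε ∘ (desubst ε (x :: p ++ q, u)).2) := by
      rw [← List.append_assoc]
      exact desubst_fixed h
    have h2 : desubst ε (x :: p ++ q, u) =
        (p ++ (q ++ [ε x]), (desubst ε (x :: p ++ q, u)).2) := by
      rw [← List.append_assoc]; rfl
    rw [List.length_cons, List.range_succ_eq_map, List.map_cons, List.map_map]
    congr 1
    · change x = u 0
      rw [h, List.cons_append, img_stdProd_cons, img_std_apply_zero]
    · refine (ih _ _ h1).trans (List.map_congr_left fun i _ => ?_)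
      rw [Function.comp_apply, Function.iterate_succ_apply, h2]

end Desubst

/-! ### Distinctness of the derivated words -/

theorem perm_fin_two_comm (σ τ : Equiv.Perm (Fin 2)) : σ * τ = τ * σ := by
  revert σ τ; decide

theorem perm_fin_two_ext {σ τ : Equiv.Perm (Fin 2)} {i : Fin 2} (h : σ i = τ i) : σ = τ := by
  revert σ τ i; decide

/-- On words containing both letters, `std x` increases the length. -/
theorem app_std_growth {x : Fin 2} {v : List (Fin 2)} (hv : ∀ i, i ∈ v) :
    (∀ i, i ∈ app (std x) v) ∧ v.length < (app (std x) v).length := by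
  obtain ⟨y, hy⟩ : ∃ y : Fin 2, y ≠ x := ⟨x + 1, by omega⟩
  obtain ⟨s, t, rfl⟩ := List.append_of_mem (hv y)
  have hs := (nonErasing_std x).length_le s
  have ht := (nonErasing_std x).length_le t
  rw [app_append, app_cons, app_std_of_ne hy]
  refine ⟨fun i => ?_, ?_⟩
  · by_cases hi : i = x
    · simp [hi]
    · simp [fin_two_eq_of_ne hi hy]
  · simp only [List.length_append, List.length_cons, List.length_nil]
    omega

theorem app_stdProd_growth (l : List (Fin 2)) {v : List (Fin 2)} (hv : ∀ i, i ∈ v) :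
    (∀ i, i ∈ app (stdProd l) v) ∧ v.length + l.length ≤ (app (stdProd l) v).length := by
  induction l with
  | nil => simpa using hv
  | cons x l ih =>
    have h1 := app_std_growth (x := x) ih.1
    rw [stdProd_cons, app_mul]
    refine ⟨h1.1, ?_⟩
    have := ih.2
    have := h1.2
    rw [List.length_cons]
    omega

theorem app_pow_growth {l : List (Fin 2)} (hl : l ≠ []) (σ : Equiv.Perm (Fin 2))
    {v : List (Fin 2)} (hv : ∀ i, i ∈ v) (k : ℕ) :
    (∀ i, i ∈ app ((stdProd l * ren σ) ^ k) v) ∧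
      v.length + k ≤ (app ((stdProd l * ren σ) ^ k) v).length := by
  induction k with
  | zero => simpa using hv
  | succ k ih =>
    have h0 : ∀ i, i ∈ (app ((stdProd l * ren σ) ^ k) v).map σ := fun i =>
      List.mem_map.2 ⟨σ.symm i, ih.1 _, by simp⟩
    have h1 := app_stdProd_growth l h0
    rw [pow_succ', app_mul, app_mul, app_ren]
    refine ⟨h1.1, ?_⟩
    have h2 := ih.2
    have h3 := h1.2
    have h4 := List.length_pos_of_ne_nil hl
    rw [List.length_map] at h3
    omega

theorem stdProd_mul_ren_ne_pow {l : List (Fin 2)} (hl : l ≠ []) (σ : Equiv.Perm (Fin 2)) {k : ℕ}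
    (hk : 2 ≤ k) : stdProd l * ren σ ≠ (stdProd l * ren σ) ^ k := by
  intro h
  obtain ⟨k, rfl⟩ := Nat.exists_eq_add_of_le hk
  have hv : ∀ i : Fin 2, i ∈ [(0 : Fin 2), 1] := by decide
  have h1 := app_pow_growth hl σ hv 1
  have h2 := app_pow_growth hl σ h1.1 (1 + k)
  rw [← app_mul, ← pow_add, add_right_comm, ← h, pow_one] at h2
  omega

/-- If shifting `s` by `m` amounts to renaming its letters by `σ`, then the composition along a
prefix of length `m q` is a `q`-th power, up to a renaming. -/
theorem pow_stdProd_pref {s : ℕ → Fin 2} {m : ℕ} {σ : Equiv.Perm (Fin 2)}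
    (h : ∀ t, s (t + m) = σ (s t)) (q : ℕ) :
    (∀ t, s (t + m * q) = (σ ^ q) (s t)) ∧
    (stdProd (pref s m) * ren σ) ^ q = stdProd (pref s (m * q)) * ren (σ ^ q) := by
  induction q with
  | zero => simp [ren_one]
  | succ q ih =>
    refine ⟨fun t => ?_, ?_⟩
    · rw [mul_add, mul_one, ← add_assoc, h, ih.1, pow_succ', Equiv.Perm.mul_apply]
    · have h1 : factorAt s (m * q) m = (pref s m).map (σ ^ q) := by
        simp only [pref, factorAt, List.map_map]
        refine List.map_congr_left fun j _ => ?_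
        rw [Function.comp_apply, ← ih.1, add_comm, zero_add]
      rw [pow_succ, ih.2, mul_assoc, ← mul_assoc (ren _), ren_mul_stdProd, ← h1, mul_assoc,
        ← ren_mul, ← pow_succ, ← mul_assoc, ← stdProd_append, ← pref_add, mul_add, mul_one]

/-- A sequence that is periodic up to renamings with two different periods gives a proper root of
the corresponding composition of morphisms. -/
theorem exists_root {s : ℕ → Fin 2} {n d i : ℕ} {ε σ : Equiv.Perm (Fin 2)}
    (hn : ∀ t, s (t + n) = ε (s t)) (hd : 0 < d) (hdn : d < n)
    (hσ : ∀ t, s (i + t + d) = σ (s (i + t))) :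
    ∃ (l : List (Fin 2)) (τ : Equiv.Perm (Fin 2)) (k : ℕ), l ≠ [] ∧ 2 ≤ k ∧
      stdProd (pref s n) * ren ε = (stdProd l * ren τ) ^ k := by
  classical
  -- By periodicity, the second relation holds from the first letter on.
  have hσ' : ∀ t, s (t + d) = σ (s t) := by
    intro t
    have h1 := (pow_stdProd_pref hn i).1
    obtain ⟨t', ht'⟩ : ∃ t', t + n * i = i + t' :=
      Nat.exists_eq_add_of_le ((Nat.le_mul_of_pos_left i (by omega)).trans (Nat.le_add_left _ _))
    have h2 := hσ t'
    rw [← ht', add_right_comm, h1, h1, ← Equiv.Perm.mul_apply, perm_fin_two_comm,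
      Equiv.Perm.mul_apply] at h2
    exact (ε ^ i).injective h2
  have hex : ∃ m, 0 < m ∧ ∃ τ : Equiv.Perm (Fin 2), ∀ t, s (t + m) = τ (s t) := ⟨d, hd, σ, hσ'⟩
  obtain ⟨hm0, τ, hτ⟩ := Nat.find_spec hex
  have hmd : Nat.find hex ≤ d := Nat.find_min' hex ⟨hd, σ, hσ'⟩
  have hmin : ∀ r < Nat.find hex, ¬(0 < r ∧ ∃ τ : Equiv.Perm (Fin 2), ∀ t, s (t + r) = τ (s t)) :=
    fun r hr => Nat.find_min hex hr
  generalize Nat.find hex = m at *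
  have hpow := pow_stdProd_pref hτ (n / m)
  have hr : n % m = 0 := by
    by_contra hr
    refine hmin (n % m) (Nat.mod_lt _ hm0) ⟨Nat.pos_of_ne_zero hr, (τ ^ (n / m))⁻¹ * ε, fun t => ?_⟩
    rw [Equiv.Perm.mul_apply, Equiv.Perm.eq_inv_iff_eq, ← hpow.1, ← hn, add_assoc, Nat.mod_add_div]
  have hdvd : m * (n / m) = n := Nat.mul_div_cancel' (Nat.dvd_of_mod_eq_zero hr)
  rw [hdvd] at hpow
  have hε : τ ^ (n / m) = ε := perm_fin_two_ext (i := s 0) (by rw [← hpow.1, hn])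
  refine ⟨pref s m, τ, n / m, List.ne_nil_of_length_pos (by simpa using hm0), ?_, ?_⟩
  · by_contra hlt
    have h1 : n / m ≤ 1 := by omega
    have h2 := Nat.mul_le_mul_left m h1
    omega
  · rw [hpow.2, hε]

theorem toClass_comp (σ : Equiv.Perm (Fin 2)) (u : ℕ → Fin 2) : toClass (σ ∘ u) = toClass u :=
  Quotient.sound (s := letterRenaming) (letterRenaming.symm ⟨σ, fun _ => rfl⟩)

theorem exists_eq_comp_of_toClass_eq {u v : ℕ → Fin 2} (h : toClass u = toClass v) :
    ∃ σ : Equiv.Perm (Fin 2), v = σ ∘ u := by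
  obtain ⟨σ, hσ⟩ := Quotient.exact h
  exact ⟨σ, funext hσ⟩

/-- The first letter of a member of a chain of desubstitutions determines the next member, so a
renaming between two members extends to the following ones. -/
theorem eq_comp_add {U : ℕ → ℕ → Fin 2} (hU : ∀ k, U k = img (std (U k 0)) (U (k + 1)))
    {i j : ℕ} {σ : Equiv.Perm (Fin 2)} (h : U j = σ ∘ U i) (t : ℕ) :
    U (j + t) = σ ∘ U (i + t) := by
  induction t with
  | zero => exact h
  | succ t ih =>
    have h0 : U (j + t) 0 = σ (U (i + t) 0) := congrFun ih 0
    rw [hU (j + t), hU (i + t), comp_img_std, h0] at ih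
    exact img_std_injective _ ih

/-- The derivated words of a fixed point `u` of `stdProd l * ren ε` are the words obtained from `u`
by successive desubstitutions. -/
theorem der_fixedPoint {l : List (Fin 2)} {ε : Equiv.Perm (Fin 2)} {u : ℕ → Fin 2} (hl : l ≠ [])
    (hu : IsSturmian u) (hfix : u = img (stdProd l * ren ε) u)
    (hpow : ∀ ξ : Morphism, IsSturmianMorphism ξ → ∀ k : ℕ, stdProd l * ren ε = ξ ^ k →
      ξ = stdProd l * ren ε) :
    (Der u).encard = l.length ∧
      (∀ c ∈ Der u, ∃ k < l.length,
        IsClassFixedBy (stdProd ((twistedCyc ε)^[k] l) * ren ε) c) ∧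
      (∀ k < l.length, ∃ c ∈ Der u,
        IsClassFixedBy (stdProd ((twistedCyc ε)^[k] l) * ren ε) c) := by
  rw [img_stdProd_mul_ren] at hfix
  set S : ℕ → List (Fin 2) × (ℕ → Fin 2) := fun k => (desubst ε)^[k] (l, u) with hS
  have hS1 : ∀ k, S (k + 1) = desubst ε (S k) := fun k => Function.iterate_succ_apply' _ _ _
  have hinv : ∀ k, (S k).1 = (twistedCyc ε)^[k] l ∧ (S k).1.length = l.length ∧
      (S k).2 = img (stdProd (S k).1) (ε ∘ (S k).2) ∧ IsSturmian (S k).2 := by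
    intro k
    induction k with
    | zero => exact ⟨rfl, rfl, hfix, hu⟩
    | succ k ih =>
      obtain ⟨h1, h2, h3, h4⟩ := ih
      rw [hS1, Function.iterate_succ_apply', ← h1]
      generalize S k = s at *
      obtain ⟨m, v⟩ := s
      refine ⟨rfl, ?_, ?_, (h4.comp ε).img_stdProd _⟩
      · cases m <;> simpa [desubst, twistedCyc] using h2
      · cases m with
        | nil => exact absurd (List.length_eq_zero_iff.1 h2.symm) hl
        | cons x m => exact desubst_fixed h3
  set U : ℕ → ℕ → Fin 2 := fun k => (S k).2 with hUdef
  have hU : ∀ k, U k = img (std (U k 0)) (U (k + 1)) := by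
    intro k
    obtain ⟨-, h2, h3, -⟩ := hinv k
    simp only [hUdef, hS1]
    generalize S k = s at *
    obtain ⟨m, v⟩ := s
    cases m with
    | nil => exact absurd (List.length_eq_zero_iff.1 h2.symm) hl
    | cons x m =>
      have h4 : v = img (std x) (desubst ε (x :: m, v)).2 := img_desubst h3
      have h5 : v 0 = x := by rw [h4, img_std_apply_zero]
      change v = img (std (v 0)) _
      rw [h5]
      exact h4
  have hper : ∀ k, U (k + l.length) = ε ∘ U k := by
    intro k
    obtain ⟨-, h2, h3, -⟩ := hinv k
    have h4 := desubst_iterate (S k).1 [] (S k).2 (by rwa [List.append_nil])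
    rw [List.append_nil, h2] at h4
    have h5 : S (k + l.length) = (desubst ε)^[l.length] (S k) := by
      rw [hS, add_comm]
      exact Function.iterate_add_apply _ _ _ _
    simp only [hUdef, h5]
    rw [show S k = ((S k).1, (S k).2) from rfl, h4]
    simp
  have hpos : 0 < l.length := List.length_pos_of_ne_nil hl
  have hmod : ∀ k, toClass (U k) = toClass (U (k % l.length)) := by
    have h1 : Function.Periodic (fun k => toClass (U k)) l.length := fun k => by
      simp only [hper, toClass_comp]
    exact fun k => (h1.map_mod_nat k).symm
  have hDer : Der u = (fun k => toClass (U k)) '' Set.Iio l.length := by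
    have h1 : Der u = {c | ∃ j, 0 < j ∧ c = toClass (U j)} :=
      der_eq hU fun k => (hinv k).2.2.2.surjective
    rw [h1]
    ext c
    constructor
    · rintro ⟨j, -, rfl⟩
      exact ⟨_, Nat.mod_lt _ hpos, (hmod j).symm⟩
    · rintro ⟨j, -, rfl⟩
      exact ⟨j + l.length, by omega, by simp only [hper, toClass_comp]⟩
  have hfixed : ∀ k, IsClassFixedBy (stdProd ((twistedCyc ε)^[k] l) * ren ε) (toClass (U k)) := by
    intro k
    obtain ⟨h1, -, h3, -⟩ := hinv k
    refine ⟨U k, (isImage_iff_eq (nonErasing_stdProd_mul_ren _ _)).2 ?_, rfl⟩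
    rw [img_stdProd_mul_ren, ← h1]
    exact h3
  have hinj : ∀ i j, i < j → j < l.length → toClass (U i) ≠ toClass (U j) := by
    intro i j hij hj h
    obtain ⟨σ, hσ⟩ := exists_eq_comp_of_toClass_eq h
    obtain ⟨m, τ, k, hm, hk, hroot⟩ := exists_root (s := fun k => U k 0) (i := i)
      (d := j - i) (ε := ε) (σ := σ) (fun t => congrFun (hper t) 0) (by omega) (by omega)
      (fun t => by
        have h1 : i + t + (j - i) = j + t := by omega
        rw [h1]
        exact congrFun (eq_comp_add hU hσ t) 0)
    have hlist : l = pref (fun k => U k 0) l.length := by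
      have h1 := eq_map_desubst (ε := ε) l [] u (by rwa [List.append_nil])
      rw [List.append_nil] at h1
      simpa [pref, factorAt] using h1
    rw [← hlist] at hroot
    have h1 := hpow _ (isSturmianMorphism_stdProd_mul_ren m τ) k hroot
    exact stdProd_mul_ren_ne_pow hm τ hk (h1.trans hroot)
  refine ⟨?_, ?_, fun k hk => ⟨_, hDer ▸ ⟨k, hk, rfl⟩, hfixed k⟩⟩
  · rw [hDer, Set.InjOn.encard_image, Set.encard_eq_coe_toFinset_card]
    · simp
    · intro i hi j hj h
      by_contra hne
      rcases Nat.lt_or_gt_of_ne hne with h1 | h1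
      · exact hinj i j h1 hj h
      · exact hinj j i h1 hi h.symm
  · rw [hDer]
    rintro _ ⟨k, hk, rfl⟩
    exact ⟨k, hk, hfixed k⟩

theorem cyc_map_stdGen (l : List (Fin 2)) (k : ℕ) :
    cyc^[k] (l.map stdGen) = ((twistedCyc 1)^[k] l).map stdGen := by
  have h : Function.Semiconj (List.map stdGen) (twistedCyc 1) cyc := by
    rintro (_ | ⟨x, l⟩) <;> simp [twistedCyc, cyc]
  exact ((h.iterate_right k) l).symm

theorem cycF_map_stdGen (l : List (Fin 2)) (k : ℕ) :
    cycF^[k] (l.map stdGen) = ((twistedCyc (Equiv.swap 0 1))^[k] l).map stdGen := by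
  have h0 : ∀ x, stdGen (Equiv.swap 0 1 x) = F (stdGen x) := by
    intro x
    fin_cases x <;> rfl
  have h : Function.Semiconj (List.map stdGen) (twistedCyc (Equiv.swap 0 1)) cycF := by
    rintro (_ | ⟨x, l⟩) <;> simp [twistedCyc, cycF, h0]
  exact ((h.iterate_right k) l).symm

/-- A standard Sturmian morphism that is not a proper power is a nontrivial composition of the
morphisms `std x`, up to a renaming, and its fixed points are Sturmian. -/
theorem exists_stdProd {ψ : Morphism} (hψ : IsStandardSturmianMorphism ψ)
    (hpow : ∀ ξ : Morphism, IsSturmianMorphism ξ → ∀ l : ℕ, ψ = ξ ^ l → ξ = ψ)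
    {u : ℕ → Fin 2} (hu : IsFixedPoint ψ u) {w : List Gen} {ε : Equiv.Perm (Fin 2)}
    (h : ψ = phi w * ren ε) :
    ∃ l : List (Fin 2), l ≠ [] ∧ w = l.map stdGen ∧ ψ = stdProd l * ren ε ∧ IsSturmian u ∧
      u = img (stdProd l * ren ε) u := by
  obtain ⟨-, c, hc, hcfix⟩ := hψ
  have hne : NonErasing ψ := h ▸ (nonErasing_phi w).mul (nonErasing_ren ε)
  have hc1 := (isImage_iff_eq hne).1 hcfix
  have hu1 := (isImage_iff_eq hne).1 hu
  have hw := hc.eq_map_stdGen (h ▸ hc1)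
  generalize w.map Gen.letter = l at hw
  subst hw
  rw [phi_map_stdGen] at h
  have hl : l ≠ [] := by
    rintro rfl
    -- A renaming fixing a word is the identity, which is a power of every renaming.
    rw [stdProd_nil, one_mul] at h
    rw [h, img_ren] at hc1
    have hε : ε = 1 := perm_fin_two_ext (i := c 0) (congrFun hc1 0).symm
    rw [hε, ren_one] at h
    have h1 := hpow (ren (Equiv.swap 0 1))
      (by simpa using isSturmianMorphism_stdProd_mul_ren [] (Equiv.swap 0 1)) 0 (by simpa using h)
    have h2 := congrArg (fun χ => app χ [0]) (h1.trans h)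
    simp [app_ren] at h2
  obtain ⟨x, m, rfl⟩ := List.exists_cons_of_ne_nil hl
  have h1 := exists_app_stdProd_cons x m ε
  rw [← h] at h1
  exact ⟨_, hl, rfl, h, fixedPoint_unique h1 hc1 hc.1.surjective hu1 ▸ hc.1, h ▸ hu1⟩

end SturmWord

theorem proposition6p1 (ψ : SturmWord.Morphism)
    (hψ : SturmWord.IsStandardSturmianMorphism ψ)
    (hpow : ∀ ξ : SturmWord.Morphism, SturmWord.IsSturmianMorphism ξ →
      ∀ l : ℕ, ψ = ξ ^ l → ξ = ψ)
    (u : ℕ → Fin 2) (hu : SturmWord.IsFixedPoint ψ u) (w : List SturmWord.Gen) :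
    (ψ = SturmWord.phi w →
      (SturmWord.Der u).encard = w.length ∧
      (∀ c ∈ SturmWord.Der u, ∃ k < w.length,
        SturmWord.IsClassFixedBy (SturmWord.phi (SturmWord.cyc^[k] w)) c) ∧
      (∀ k < w.length, ∃ c ∈ SturmWord.Der u,
        SturmWord.IsClassFixedBy (SturmWord.phi (SturmWord.cyc^[k] w)) c)) ∧
    (ψ = SturmWord.phi w * SturmWord.E →
      (SturmWord.Der u).encard = w.length ∧
      (∀ c ∈ SturmWord.Der u, ∃ k < w.length,
        SturmWord.IsClassFixedBy (SturmWord.phi (SturmWord.cycF^[k] w) * SturmWord.E) c) ∧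
      (∀ k < w.length, ∃ c ∈ SturmWord.Der u,
        SturmWord.IsClassFixedBy (SturmWord.phi (SturmWord.cycF^[k] w) * SturmWord.E) c)) := by
  constructor
  · intro h
    obtain ⟨l, hl, rfl, rfl, hs, hfix⟩ := SturmWord.exists_stdProd hψ hpow hu (ε := 1)
      (by rw [SturmWord.ren_one, mul_one]; exact h)
    have := SturmWord.der_fixedPoint hl hs hfix hpow
    simpa only [List.length_map, SturmWord.cyc_map_stdGen, SturmWord.phi_map_stdGen,
      SturmWord.ren_one, mul_one] using this
  · intro h
    rw [SturmWord.E_eq] at h ⊢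
    obtain ⟨l, hl, rfl, rfl, hs, hfix⟩ := SturmWord.exists_stdProd hψ hpow hu h
    have := SturmWord.der_fixedPoint hl hs hfix hpow
    simpa only [List.length_map, SturmWord.cycF_map_stdGen, SturmWord.phi_map_stdGen] using this
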